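/- Let $M$ be a smooth manifold of dimension $p+q$ and $H\subseteq TM$ a smooth distribution of rank $p$. All curves are smooth near $t=0$. Parabolic arrows. $H$-coordinates at $x\in M$ are smooth coordinates with values in $\mathbb R^p\times\mathbb R^q$, centred at $x$, whose first $p$ coordinate vectors at $x$ span $H_x$. For curves $c_1,c_2$ through $x$ at $t=0$ with $c_i'(0)\in H_x$, write $c_1\sim_H c_2$ if in $H$-coordinates at $x$ one has $c_1'(0)=c_2'(0)$ and $c_1''(0)-c_2''(0)\in H_x$. The classes $[c]_H$ form the set $T_HM_x$, and $T_HM=\bigsqcup_x T_HM_x$. Dilations are $\delta_s[c]_H=[t\mapsto c(st)]_H$. A parabolic flow is a smooth local flow $(x,t)\mapsto\Phi_t(x)$, $\Phi_0=\mathrm{id}$, with $\partial_t\Phi_t(x)|_{t=0}\in H_x$ for all $x$; write $\Phi^x(t)=\Phi_t(x)$. The groupoid. If $E_x:\mathbb R^p\times\mathbb R^q\to M$ are (inverse) $H$-coordinates at $x$ depending smoothly on $x$ in an open set, put $F_x(h,k)=[t\mapsto E_x(th,t^2k)]_H\in T_HM_x$; the maps $(x,h,k)\mapsto F_x(h,k)$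 are the local parametrizations of the smooth structure of $T_HM$. An $H$-adapted exponential map over an open set $U\subseteq M$ is a smooth map $\exp:T_HM|_U\to M$ such that for each $v\in T_HM_x$, $x\in U$, the curve $t\mapsto\exp_x(\delta_tv)$ represents $v$. As a set, the parabolic tangent groupoid is $\mathbb T_HM=T_HM\sqcup\bigl(M\times M\times(0,1]\bigr)$. It carries the topology of the manifold structure glued from $M\times M\times(0,1]$ and from the maps $\psi:T_HM|_U\times[0,1)\to\mathbb T_HM$, $\psi(x,v,t)=(\exp_x(\delta_tv),x,t)$ for $t>0$, $\psi(x,v,0)=(x,v)$, for all $H$-adapted exponential maps $\exp$: a subset is open iff its inverse images in $M\times M\times(0,1]$ and under all these $\psi$ are open. Statement. Let $a,b$ be smooth curves in $M$ with $a(0)=b(0)=m$ and $a'(0),b'(0)\in H_m$. Then $T_HM_m$ is a group under the (well-defined) product $[\Phi^m]_H*[\Psi^m]_H=[\,t\mapsto\Phi_t(\Psi_t(m))\,]_H$ of the arrows of parabolic flows $\Phi,\Psi$ defined near $(m,0)$, every pair of arrows at $m$ arises from such flows, and in $\mathbb T_HM$ $$\lim_{t\to0^+}\,(a(t),b(t),t)=[a]_H*[b]_H^{-1}\in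 T_HM_m .$$ -/

import Mathlib

open Set Filter
open scoped Manifold ContDiff Topology

noncomputable section

namespace Parabolic

/-- The coordinate space `ℝ^p × ℝ^q = ℝ^(p+q)`; a point is written `x = (x^H, x^N)`. -/
abbrev Coord (p q : ℕ) : Type := EuclideanSpace ℝ (Fin p) × EuclideanSpace ℝ (Fin q)

section

variable {p q : ℕ} {M : Type*} [TopologicalSpace M]
  [ChartedSpace (EuclideanSpace ℝ (Fin (p + q))) M] [IsManifold (𝓡 (p + q)) ∞ M]

variable (p q M) in
/-- A smooth distribution `H ⊆ TM` of rank `p` on the `(p+q)`-dimensional manifold `M`, i.e. a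
family of subspaces that is locally the span of `p` linearly independent smooth vector fields. -/
structure TangentDistribution where
  /-- The fibre `H_x ⊆ T_xM`. -/
  fiber : ∀ x : M, Submodule ℝ (TangentSpace (𝓡 (p + q)) x)
  exists_frame : ∀ x : M, ∃ U : Set M, IsOpen U ∧ x ∈ U ∧
    ∃ X : Fin p → ∀ y : M, TangentSpace (𝓡 (p + q)) y,
      (∀ i, ContMDiffOn (𝓡 (p + q)) (𝓡 (p + q)).tangent ∞
        (fun y => (⟨y, X i y⟩ : TangentBundle (𝓡 (p + q)) M)) U) ∧
      ∀ y ∈ U, LinearIndependent ℝ (fun i => X i y) ∧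
        Submodule.span ℝ (range fun i => X i y) = fiber y

variable (H : TangentDistribution p q M)

/-- `c` is a smooth curve through `c(0) = m` (smooth on an interval around `0`) that is tangent to
`H` at `t = 0`. Only the germ of a curve at `t = 0` matters, so no fixed interval is prescribed. -/
structure IsHCurve (m : M) (c : ℝ → M) : Prop where
  base : c 0 = m
  smooth : ∃ ε > 0, ContMDiffOn 𝓘(ℝ, ℝ) (𝓡 (p + q)) ∞ c (Ioo (-ε) ε)
  tangent : mfderiv 𝓘(ℝ, ℝ) (𝓡 (p + q)) c 0 (1 : ℝ) ∈ H.fiber (c 0)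

/-- `φ` is an `H`-coordinate chart at `m`: a smooth chart with `φ(m) = 0` for which the first `p`
coordinate vectors at `m` span `H_m`, that is, `H_m` consists of the vectors whose last `q`
coordinates vanish. -/
structure IsHChart (m : M) (φ : OpenPartialHomeomorph M (Coord p q)) : Prop where
  mem_source : m ∈ φ.source
  map_base : φ m = 0
  smooth : ContMDiffOn (𝓡 (p + q)) 𝓘(ℝ, Coord p q) ∞ φ φ.source
  smooth_symm : ContMDiffOn 𝓘(ℝ, Coord p q) (𝓡 (p + q)) ∞ φ.symm φ.target
  mem_fiber_iff : ∀ v : TangentSpace (𝓡 (p + q)) m,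
    v ∈ H.fiber m ↔
      Prod.snd (α := EuclideanSpace ℝ (Fin p)) (β := EuclideanSpace ℝ (Fin q))
        (mfderiv (𝓡 (p + q)) 𝓘(ℝ, Coord p q) φ m v) = 0

/-- The relation `c₁ ∼_H c₂` for curves through `m` tangent to `H`: in `H`-coordinates at `m`,
`c₁'(0) = c₂'(0)` and `c₁''(0) - c₂''(0)` lies in `H_m`. -/
def HEquiv (m : M) (c₁ c₂ : ℝ → M) : Prop :=
  ∀ φ : OpenPartialHomeomorph M (Coord p q), IsHChart H m φ →
    deriv (fun t => φ (c₁ t)) 0 = deriv (fun t => φ (c₂ t)) 0 ∧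
    (iteratedDeriv 2 (fun t => φ (c₁ t)) 0 - iteratedDeriv 2 (fun t => φ (c₂ t)) 0).2 = 0

/-- Equivalence of curves through `m` as a setoid. -/
def curveSetoid (m : M) : Setoid {c : ℝ → M // IsHCurve H m c} where
  r c₁ c₂ := HEquiv H m c₁.1 c₂.1
  iseqv :=
    { refl := fun _ _ _ => ⟨rfl, by simp⟩
      symm := fun h φ hφ => ⟨(h φ hφ).1.symm, by
        rw [← neg_sub, Prod.snd_neg, (h φ hφ).2, neg_zero]⟩
      trans := fun h k φ hφ => ⟨(h φ hφ).1.trans (k φ hφ).1, by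
        rw [← sub_add_sub_cancel, Prod.snd_add, (h φ hφ).2, (k φ hφ).2, add_zero]⟩ }

/-- The set `T_HM_m` of parabolic arrows at `m`. -/
def Arrow (m : M) : Type _ := Quotient (curveSetoid H m)

variable {H}

/-- The parabolic arrow `[c]_H`. -/
def arrow {m : M} {c : ℝ → M} (hc : IsHCurve H m c) : Arrow H m :=
  Quotient.mk (curveSetoid H m) ⟨c, hc⟩

/-- The curve `c` represents the parabolic arrow `v`, i.e. `[c]_H = v`. -/
def Represents {m : M} (c : ℝ → M) (v : Arrow H m) : Prop :=
  ∃ hc : IsHCurve H m c, arrow hc = v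

theorem isHCurve_const (m : M) : IsHCurve H m (fun _ => m) where
  base := rfl
  smooth := ⟨1, one_pos, contMDiffOn_const⟩
  tangent := by
    rw [mfderiv_const]
    exact (H.fiber m).zero_mem

theorem IsHCurve.rescale {m : M} {c : ℝ → M} (hc : IsHCurve H m c) (s : ℝ) :
    IsHCurve H m (fun t => c (s * t)) := by
  obtain ⟨h0, ⟨ε, hε, hs⟩, ht⟩ := hc
  have hcont : ContMDiff 𝓘(ℝ, ℝ) 𝓘(ℝ, ℝ) ∞ (fun t : ℝ => s * t) :=
    (contDiff_const.mul contDiff_id).contMDiff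
  refine ⟨by simpa using h0, ?_, ?_⟩
  · refine ⟨ε / (|s| + 1), by positivity, hs.comp hcont.contMDiffOn ?_⟩
    intro t htm
    have h1 : |t| < ε / (|s| + 1) := abs_lt.2 htm
    have h2 : |t| * (|s| + 1) < ε := (lt_div_iff₀ (by positivity)).1 h1
    have h3 : |s * t| < ε := by
      rw [abs_mul]; nlinarith [abs_nonneg t, abs_nonneg s]
    exact abs_lt.1 h3
  · have hd : MDifferentiableAt 𝓘(ℝ, ℝ) (𝓡 (p + q)) c (s * 0) := by
      rw [mul_zero]
      exact (hs.contMDiffAt (Ioo_mem_nhds (by linarith) hε)).mdifferentiableAt (by simp)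
    have hm : MDifferentiableAt 𝓘(ℝ, ℝ) 𝓘(ℝ, ℝ) (fun t : ℝ => s * t) 0 :=
      hcont.mdifferentiableAt (by simp)
    have key := mfderiv_comp_apply (0 : ℝ) hd hm (1 : ℝ)
    have hv : mfderiv 𝓘(ℝ, ℝ) 𝓘(ℝ, ℝ) (fun t : ℝ => s * t) 0 (1 : ℝ) = s • (1 : ℝ) := by
      rw [mfderiv_eq_fderiv]
      exact (by simp : deriv (fun t : ℝ => s * t) 0 = s • (1 : ℝ))
    have aux : ∀ r : ℝ, r = 0 → ∀ w : ℝ, w = s • (1 : ℝ) →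
        mfderiv 𝓘(ℝ, ℝ) (𝓡 (p + q)) c r w ∈ H.fiber (c r) := by
      rintro r rfl w rfl
      exact (map_smul (mfderiv 𝓘(ℝ, ℝ) (𝓡 (p + q)) c 0) s (1 : ℝ)) ▸ (H.fiber (c 0)).smul_mem s ht
    have := aux (s * 0) (mul_zero s) _ hv
    rw [← key] at this
    exact this

theorem HEquiv.rescale {m : M} {c₁ c₂ : ℝ → M} (h : HEquiv H m c₁ c₂) (s : ℝ) :
    HEquiv H m (fun t => c₁ (s * t)) (fun t => c₂ (s * t)) := by
  have d1 : ∀ f : ℝ → Coord p q, deriv (fun t => f (s * t)) = fun t => s • deriv f (s * t) :=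
    fun f => funext fun t => deriv_comp_mul_left s f t
  have d2 : ∀ f : ℝ → Coord p q,
      iteratedDeriv 2 (fun t => f (s * t)) 0 = (s * s) • iteratedDeriv 2 f 0 := by
    intro f
    simp only [iteratedDeriv_succ, iteratedDeriv_zero]
    rw [d1]
    have : (fun t => s • deriv f (s * t)) = fun t => (s • deriv f) (s * t) := rfl
    rw [this, d1]
    have h2 : deriv (s • deriv f) = s • deriv (deriv f) := by
      funext t
      rw [Pi.smul_apply]
      exact deriv_const_smul_field s (deriv f)
    simp [h2, mul_smul]
  intro φ hφ
  obtain ⟨h1, h2⟩ := h φ hφ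
  refine ⟨?_, ?_⟩
  · have e1 := congrFun (d1 fun t => φ (c₁ t)) 0
    have e2 := congrFun (d1 fun t => φ (c₂ t)) 0
    simp only [mul_zero] at e1 e2
    rw [e1, e2, h1]
  · rw [d2 (fun t => φ (c₁ t)), d2 (fun t => φ (c₂ t)), ← smul_sub, Prod.smul_snd, h2, smul_zero]

/-- The dilation `δ_s [c]_H = [c_s]_H`, where `c_s(t) = c(st)`. -/
def Arrow.dilate {m : M} (s : ℝ) (v : Arrow H m) : Arrow H m :=
  Quotient.map' (s₁ := curveSetoid H m) (s₂ := curveSetoid H m)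
    (fun c => ⟨fun t => c.1 (s * t), c.2.rescale s⟩) (fun _ _ h => HEquiv.rescale h s) v

variable (H)

/-- A parabolic flow: a smooth map `(x, t) ↦ Φ_t(x)` on an open set `dom ⊆ M × ℝ` with
`Φ_0 = id` whose generating vector field at `t = 0` is a section of `H`. (By the inverse function
theorem each `Φ_t` is a local diffeomorphism near the points `(x, 0)`; values outside `dom` are
irrelevant.) -/
structure ParabolicFlow where
  /-- The domain of the local flow. -/
  dom : Set (M × ℝ)
  isOpen_dom : IsOpen dom
  /-- The map `x ↦ t ↦ Φ_t(x)`. -/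
  toFun : M → ℝ → M
  smooth : ContMDiffOn ((𝓡 (p + q)).prod 𝓘(ℝ, ℝ)) (𝓡 (p + q)) ∞ (fun z => toFun z.1 z.2) dom
  map_zero : ∀ x, (x, (0 : ℝ)) ∈ dom → toFun x 0 = x
  tangent : ∀ x, (x, (0 : ℝ)) ∈ dom →
    mfderiv 𝓘(ℝ, ℝ) (𝓡 (p + q)) (toFun x) 0 (1 : ℝ) ∈ H.fiber (toFun x 0)

variable {H}

/-- `w` is the composition of the parabolic arrows `u` and `v` at `m`: there are parabolic flows
`Φ`, `Ψ` with `u = [Φ^m]_H`, `v = [Ψ^m]_H` and `w = [(Φ ∘ Ψ)^m]_H`, where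
`(Φ ∘ Ψ)^m(t) = Φ_t(Ψ_t(m))`. -/
def IsComposition {m : M} (u v w : Arrow H m) : Prop :=
  ∃ Φ Ψ : ParabolicFlow H, (m, (0 : ℝ)) ∈ Φ.dom ∧ (m, (0 : ℝ)) ∈ Ψ.dom ∧
    Represents (Φ.toFun m) u ∧ Represents (Ψ.toFun m) v ∧
    Represents (fun t => Φ.toFun (Ψ.toFun m t) t) w

variable (H)

/-- A smooth local system of `H`-coordinates: `H`-coordinates `E_x : ℝ^(p+q) → M` at each point
`x` of an open set `dom`, with `(x, v) ↦ E_x(v)` smooth. -/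
structure HCoordSystem where
  /-- The open set of base points. -/
  dom : Set M
  isOpen_dom : IsOpen dom
  /-- The map `x ↦ v ↦ E_x(v)`. -/
  toFun : M → Coord p q → M
  smooth : ContMDiffOn ((𝓡 (p + q)).prod 𝓘(ℝ, Coord p q)) (𝓡 (p + q)) ∞
    (fun z : M × Coord p q => toFun z.1 z.2) (dom ×ˢ univ)
  exists_chart : ∀ x ∈ dom, ∃ φ : OpenPartialHomeomorph M (Coord p q),
    IsHChart H x φ ∧ φ.target = univ ∧ ∀ v, toFun x v = φ.symm v

variable {H}

theorem HCoordSystem.isHCurve (E : HCoordSystem H) {x : M} (hx : x ∈ E.dom) (v : Coord p q) :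
    IsHCurve H x (fun t => E.toFun x (t • v.1, t ^ 2 • v.2)) := by
  obtain ⟨φ, hφ, htar, hE⟩ := E.exists_chart x hx
  obtain ⟨hmem, hbase, hsm, hsms, hfib⟩ := hφ
  have hfun : (fun t : ℝ => E.toFun x (t • v.1, t ^ 2 • v.2)) =
      fun t => φ.symm (t • v.1, t ^ 2 • v.2) := funext fun t => hE _
  rw [hfun]
  have hpoly : ContDiff ℝ ∞ (fun t : ℝ => ((t • v.1, t ^ 2 • v.2) : Coord p q)) := by fun_prop
  rw [htar, contMDiffOn_univ] at hsms
  have hc : ContMDiff 𝓘(ℝ, ℝ) (𝓡 (p + q)) ∞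
      (fun t : ℝ => φ.symm (t • v.1, t ^ 2 • v.2)) := hsms.comp hpoly.contMDiff
  have h0 : φ.symm ((0 : ℝ) • v.1, (0 : ℝ) ^ 2 • v.2) = x := by
    have : (((0 : ℝ) • v.1, (0 : ℝ) ^ 2 • v.2) : Coord p q) = φ x := by rw [hbase]; simp
    rw [this, φ.left_inv hmem]
  refine ⟨h0, ⟨1, one_pos, hc.contMDiffOn⟩, ?_⟩
  have aux : ∀ y, y = x → ∀ w : TangentSpace (𝓡 (p + q)) y,
      Prod.snd (α := EuclideanSpace ℝ (Fin p)) (β := EuclideanSpace ℝ (Fin q))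
        (mfderiv (𝓡 (p + q)) 𝓘(ℝ, Coord p q) φ y w) = 0 →
      w ∈ H.fiber y := by
    rintro y rfl w hw
    exact (hfib w).2 hw
  refine aux _ h0 _ ?_
  have hdφ : MDifferentiableAt (𝓡 (p + q)) 𝓘(ℝ, Coord p q) φ
      (φ.symm ((0 : ℝ) • v.1, (0 : ℝ) ^ 2 • v.2)) := by
    rw [h0]
    exact (hsm.contMDiffAt (φ.open_source.mem_nhds hmem)).mdifferentiableAt (by simp)
  have hdc : MDifferentiableAt 𝓘(ℝ, ℝ) (𝓡 (p + q))
      (fun t : ℝ => φ.symm (t • v.1, t ^ 2 • v.2)) 0 := hc.mdifferentiableAt (by simp)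
  have key := mfderiv_comp_apply (0 : ℝ) hdφ hdc (1 : ℝ)
  have hcomp : (φ ∘ fun t : ℝ => φ.symm (t • v.1, t ^ 2 • v.2)) =
      fun t : ℝ => ((t • v.1, t ^ 2 • v.2) : Coord p q) :=
    funext fun t => φ.right_inv (by rw [htar]; trivial)
  have hder : HasDerivAt (fun t : ℝ => ((t • v.1, t ^ 2 • v.2) : Coord p q))
      ((1 : ℝ) • v.1, ((2 : ℕ) * (0 : ℝ) ^ (2 - 1)) • v.2) 0 :=
    ((hasDerivAt_id (0 : ℝ)).smul_const v.1).prodMk ((hasDerivAt_pow 2 (0 : ℝ)).smul_const v.2)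
  have hval : Prod.snd (α := EuclideanSpace ℝ (Fin p)) (β := EuclideanSpace ℝ (Fin q))
      (mfderiv 𝓘(ℝ, ℝ) 𝓘(ℝ, Coord p q)
        (φ ∘ fun t : ℝ => φ.symm (t • v.1, t ^ 2 • v.2)) 0 (1 : ℝ)) = 0 := by
    rw [hcomp, mfderiv_eq_fderiv]
    have : deriv (fun t : ℝ => ((t • v.1, t ^ 2 • v.2) : Coord p q)) 0 = _ := hder.deriv
    exact (congrArg Prod.snd this).trans (by simp)
  rw [key] at hval
  exact hval

open Classical in
/-- The Taylor coordinates `F_x : ℝ^(p+q) → T_HM_x`, `F_x(h, n) = [t ↦ E_x(th, t²n)]_H`, induced by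
the `H`-coordinates `E_x` (`x ∈ dom`; a dummy value elsewhere). -/
def HCoordSystem.taylor (E : HCoordSystem H) (x : M) (v : Coord p q) : Arrow H x :=
  if hx : x ∈ E.dom then arrow (E.isHCurve hx v) else arrow (isHCurve_const x)

variable (H)

/-- An `H`-adapted exponential map `exp : T_HM → M`, defined over an open set `dom ⊆ M` (possibly
all of `M`): it is smooth, and for each arrow `v` at `x` the curve `t ↦ exp_x(δ_t v)` represents
`v`. Smoothness refers to the smooth structure of `T_HM` in which the fibrewise Taylor coordinates
`(x, h, n) ↦ F_x(h, n)` of the smooth systems of `H`-coordinates are the local parametrizations. -/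
structure HAdaptedExp where
  /-- The open set over which the map is defined. -/
  dom : Set M
  isOpen_dom : IsOpen dom
  /-- The maps `exp_x : T_HM_x → M`. -/
  toFun : ∀ x : M, Arrow H x → M
  smooth : ∀ x ∈ dom, ∃ E : HCoordSystem H, x ∈ E.dom ∧
    ContMDiffOn ((𝓡 (p + q)).prod 𝓘(ℝ, Coord p q)) (𝓡 (p + q)) ∞
      (fun z : M × Coord p q => toFun z.1 (E.taylor z.1 z.2)) ((dom ∩ E.dom) ×ˢ univ)
  adapted : ∀ x ∈ dom, ∀ v : Arrow H x, Represents (fun t => toFun x (v.dilate t)) v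

/-- The underlying set of the parabolic tangent groupoid: the disjoint union of `T_HM` (at `t = 0`)
and `M × M × (0,1]`. -/
inductive TangentGroupoid : Type _
  | zero (x : M) (v : Arrow H x) : TangentGroupoid
  | pair (x y : M) (t : Ioc (0 : ℝ) 1) : TangentGroupoid

variable {H}

/-- The map `ψ : T_HM × [0,1) → 𝕋_HM` defined by an `H`-adapted exponential map:
`ψ(x, v, t) = (exp_x(δ_t v), x, t)` for `t > 0`, and `ψ(x, v, 0) = (x, v) ∈ T_HM`. -/
def HAdaptedExp.psi (e : HAdaptedExp H) (x : M) (v : Arrow H x) (t : Ico (0 : ℝ) 1) :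
    TangentGroupoid H :=
  if ht : 0 < (t : ℝ) then
    TangentGroupoid.pair (e.toFun x (v.dilate t)) x ⟨t, ht, t.2.2.le⟩
  else TangentGroupoid.zero x v

/-- The topology of the manifold (with boundary) `𝕋_HM`, whose smooth structure is glued from that
of `M × M × (0,1]` and from the maps `ψ` of `H`-adapted exponential maps: a set is open if and only
if its inverse images under the inclusion of `M × M × (0,1]` and under all the parametrizations
`(x, h, n, t) ↦ ψ(x, F_x(h, n), t)` are open. -/
instance : TopologicalSpace (TangentGroupoid H) where
  IsOpen W :=
    IsOpen {z : M × M × Ioc (0 : ℝ) 1 | TangentGroupoid.pair z.1 z.2.1 z.2.2 ∈ W} ∧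
    ∀ (e : HAdaptedExp H) (E : HCoordSystem H),
      IsOpen {z : M × Coord p q × Ico (0 : ℝ) 1 |
        z.1 ∈ e.dom ∩ E.dom ∧ e.psi z.1 (E.taylor z.1 z.2.1) z.2.2 ∈ W}
  isOpen_univ := by
    refine ⟨by simp, fun e E => ?_⟩
    convert (e.isOpen_dom.inter E.isOpen_dom).preimage
      (continuous_fst : Continuous fun z : M × Coord p q × Ico (0 : ℝ) 1 => z.1) using 1
    ext z
    simp
  isOpen_inter := by
    rintro s t ⟨hs, hs'⟩ ⟨ht, ht'⟩
    refine ⟨hs.inter ht, fun e E => ?_⟩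
    convert (hs' e E).inter (ht' e E) using 1
    ext z
    simp only [mem_ofPred_eq, mem_inter_iff]
    tauto
  isOpen_sUnion := by
    intro S hS
    refine ⟨?_, fun e E => ?_⟩
    · convert isOpen_biUnion fun s hs => (hS s hs).1 using 1
      ext z
      simp
    · convert isOpen_biUnion fun s hs => (hS s hs).2 e E using 1
      ext z
      simp only [mem_ofPred_eq, mem_sUnion, mem_iUnion, exists_prop]
      tauto

end

end Parabolic

end

noncomputable section

namespace Parabolic

/-! Everything is computed in a chart `L` centred at `m` carrying a frame `A(z)` with `A(0) = id`
whose first `p` columns span `H`. A curve tangent to `H` at `m` has parabolic coordinates `(h, n)`,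
the `H`-part of its velocity and half the normal part of its acceleration. A coordinate change
between `H`-charts preserves `H` to first order, so one `H`-chart detects equality of arrows and
arrows at `m` correspond bijectively to pairs `(h, n)` (`IsHChart.hEquiv_iff`).

Group law. Write `b(h, h')` for the normal part of `(∂_h A)(0) h'`. For `G(s, t) = L(Φ_t(Ψ_s(m)))`,
the second derivative on the diagonal is `G_ss + 2 G_st + G_tt`. The generator of `Φ` along `Ψ^m` is
`A k` with `k` having zero normal part, so the normal part of `G_st` is `b(h_Ψ, h_Φ)`. Hence `(h',
n') * (h, n) = (h' + h, n' + n + b(h, h'))`, which is a group law by bilinearity of `b` alone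
(`AdaptedFrame.comp_flow`). Explicit flows realise every arrow, which gives `isComposition_iff`.

Limit. Put `k(t) = A(b(t))⁻¹(a(t) - b(t))` in the chart. Differentiating `A k = a - b` twice at `0`
shows that the coordinates of `k` are exactly those of `[a] * [b]⁻¹` (`tendsto_frame_symm_sub`). The
`H`-coordinates `E_x(v) = L⁻¹(L(x) + σ(A(x) v))`, with `σ` a radial diffeomorphism onto a small
neighbourhood of `0`, satisfy `E_b⁻¹(a) = s k` for a scalar `s → 1`. So the rescaled point `δ_{1/t}
E_b⁻¹(a)` has the same limit. Since the topology of the groupoid makes each `ψ` continuous,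
convergence in this single parametrization is enough (`tendsto_pair`). -/

/-! ### Second-order calculus for curves and two-parameter maps -/

theorem tendsto_inv_smul_of_hasDerivAt {E : Type*} [NormedAddCommGroup E] [NormedSpace ℝ E]
    {g : ℝ → E} {g' : E} (h : HasDerivAt g g' 0) (h0 : g 0 = 0) :
    Tendsto (fun t : ℝ => t⁻¹ • g t) (𝓝[≠] 0) (𝓝 g') := by
  have := hasDerivAt_iff_tendsto_slope.1 h
  refine this.congr fun t => ?_
  simp [slope_def_module, h0]

/-- A twice differentiable curve with vanishing value and first derivative at `0` satisfies
`g t / t ^ 2 → g''(0) / 2`. -/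
theorem tendsto_inv_sq_smul {E : Type*} [NormedAddCommGroup E] [NormedSpace ℝ E]
    {g : ℝ → E} (hg : ContDiffAt ℝ 2 g 0) (h0 : g 0 = 0) (h1 : deriv g 0 = 0) :
    Tendsto (fun t : ℝ => (t⁻¹) ^ 2 • g t) (𝓝[≠] 0) (𝓝 ((1 / 2 : ℝ) • deriv (deriv g) 0)) := by
  obtain ⟨u, hu, hgu⟩ := hg.contDiffOn le_rfl (by simp)
  obtain ⟨ε, hε, hball⟩ := Metric.mem_nhds_iff.1 (by simpa using hu : u ∈ 𝓝 (0 : ℝ))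
  have hs : Convex ℝ (Metric.ball (0 : ℝ) ε) := convex_ball _ _
  have h0s : (0 : ℝ) ∈ Metric.ball (0 : ℝ) ε := Metric.mem_ball_self hε
  have hnhds : Metric.ball (0 : ℝ) ε ∈ 𝓝 (0 : ℝ) := Metric.ball_mem_nhds _ hε
  have key := taylor_tendsto (n := 2) hs h0s (hgu.mono hball)
  rw [nhdsWithin_eq_nhds.2 hnhds] at key
  have key' := (key.mono_left (nhdsWithin_le_nhds (s := {0}ᶜ))).add_const
    ((1 / 2 : ℝ) • deriv (deriv g) 0)
  rw [zero_add] at key'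
  refine key'.congr' ?_
  filter_upwards [self_mem_nhdsWithin] with t ht
  have ht : t ≠ 0 := ht
  have e1 : iteratedDerivWithin 1 g (Metric.ball (0 : ℝ) ε) 0 = deriv g 0 := by
    rw [iteratedDerivWithin_of_isOpen Metric.isOpen_ball h0s, iteratedDeriv_one]
  have e2 : iteratedDerivWithin 2 g (Metric.ball (0 : ℝ) ε) 0 = deriv (deriv g) 0 := by
    rw [iteratedDerivWithin_of_isOpen Metric.isOpen_ball h0s, iteratedDeriv_succ,
      iteratedDeriv_one]
  rw [taylorWithinEval_succ, taylorWithinEval_succ, taylor_within_zero_eval]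
  norm_num [e1, e2, h0, h1]
  rw [smul_sub, smul_smul, ← sub_eq_zero]
  rw [show (t ^ 2)⁻¹ * (1 / 2 * t ^ 2) = (1 / 2 : ℝ) by field_simp]
  abel

theorem contDiffAt_deriv {E : Type*} [NormedAddCommGroup E] [NormedSpace ℝ E]
    {g : ℝ → E} {t : ℝ} {k n : WithTop ℕ∞} (hg : ContDiffAt ℝ k g t) (h : n + 1 ≤ k) :
    ContDiffAt ℝ n (deriv g) t :=
  (hg.fderiv_right h).clm_apply contDiffAt_const

theorem deriv_deriv_comp {E F : Type*} [NormedAddCommGroup E] [NormedSpace ℝ E]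
    [NormedAddCommGroup F] [NormedSpace ℝ F] {f : E → F} {g : ℝ → E} {t : ℝ}
    (hf : ContDiffAt ℝ 2 f (g t)) (hg : ContDiffAt ℝ 2 g t) :
    deriv (deriv fun s => f (g s)) t =
      fderiv ℝ (fderiv ℝ f) (g t) (deriv g t) (deriv g t) +
        fderiv ℝ f (g t) (deriv (deriv g) t) := by
  have hf1 : ∀ᶠ y in 𝓝 (g t), DifferentiableAt ℝ f y :=
    (hf.eventually (by simp)).mono fun y hy => hy.differentiableAt (by simp)
  have hg1 : ∀ᶠ s in 𝓝 t, DifferentiableAt ℝ g s :=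
    (hg.eventually (by simp)).mono fun y hy => hy.differentiableAt (by simp)
  have e : (deriv fun s => f (g s)) =ᶠ[𝓝 t] fun s => fderiv ℝ f (g s) (deriv g s) := by
    filter_upwards [hg.continuousAt.eventually hf1, hg1] with s h1 h2
    exact fderiv_comp_deriv s h1 h2
  rw [e.deriv_eq]
  have d1 : DifferentiableAt ℝ (fderiv ℝ f) (g t) :=
    (hf.fderiv_right (m := 1) (by norm_num)).differentiableAt (by simp)
  have d2 : DifferentiableAt ℝ (deriv g) t :=
    (contDiffAt_deriv (n := 1) hg (by norm_num)).differentiableAt (by simp)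
  have d3 : HasDerivAt g (deriv g t) t := hg1.self_of_nhds.hasDerivAt
  exact ((d1.hasFDerivAt.comp_hasDerivAt t d3).clm_apply d2.hasDerivAt).deriv

/-- The Leibniz rule to second order. Applied to `A k = x - y` with `k 0 = 0`, it isolates the
second derivative of `k`, the quantity that governs the limit. -/
theorem deriv_deriv_clm_apply {E F : Type*} [NormedAddCommGroup E] [NormedSpace ℝ E]
    [NormedAddCommGroup F] [NormedSpace ℝ F] {A : ℝ → E →L[ℝ] F} {k : ℝ → E} {t : ℝ}
    (hA : ContDiffAt ℝ 2 A t) (hk : ContDiffAt ℝ 2 k t) :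
    deriv (deriv fun s => A s (k s)) t =
      deriv (deriv A) t (k t) + (2 : ℝ) • deriv A t (deriv k t) + A t (deriv (deriv k) t) := by
  have hA1 : ∀ᶠ s in 𝓝 t, DifferentiableAt ℝ A s :=
    (hA.eventually (by simp)).mono fun y hy => hy.differentiableAt (by simp)
  have hk1 : ∀ᶠ s in 𝓝 t, DifferentiableAt ℝ k s :=
    (hk.eventually (by simp)).mono fun y hy => hy.differentiableAt (by simp)
  have e : (deriv fun s => A s (k s)) =ᶠ[𝓝 t] fun s => deriv A s (k s) + A s (deriv k s) := by
    filter_upwards [hA1, hk1] with s h1 h2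
    exact (h1.hasDerivAt.clm_apply h2.hasDerivAt).deriv
  have dA : HasDerivAt (deriv A) (deriv (deriv A) t) t :=
    ((contDiffAt_deriv (n := 1) hA (by norm_num)).differentiableAt (by simp)).hasDerivAt
  have dk : HasDerivAt (deriv k) (deriv (deriv k) t) t :=
    ((contDiffAt_deriv (n := 1) hk (by norm_num)).differentiableAt (by simp)).hasDerivAt
  rw [e.deriv_eq, ((dA.clm_apply hk1.self_of_nhds.hasDerivAt).fun_add
    (hA1.self_of_nhds.hasDerivAt.clm_apply dk)).deriv]
  module

section diagonal

variable {F : Type*} [NormedAddCommGroup F] [NormedSpace ℝ F] {G : ℝ × ℝ → F}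

theorem deriv_diagonal (hG : DifferentiableAt ℝ G 0) :
    deriv (fun t => G (t, t)) 0 = deriv (fun s => G (s, 0)) 0 + deriv (fun t => G (0, t)) 0 := by
  have h : HasFDerivAt G (fderiv ℝ G 0) ((0 : ℝ), (0 : ℝ)) := hG.hasFDerivAt
  have i := hasDerivAt_id (0 : ℝ)
  have z := hasDerivAt_const (0 : ℝ) (0 : ℝ)
  have h1 := HasFDerivAt.comp_hasDerivAt (f := fun t : ℝ => (t, t)) (0 : ℝ) h (i.prodMk i)
  have h2 := HasFDerivAt.comp_hasDerivAt (f := fun t : ℝ => (t, (0 : ℝ))) (0 : ℝ) h (i.prodMk z)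
  have h3 := HasFDerivAt.comp_hasDerivAt (f := fun t : ℝ => ((0 : ℝ), t)) (0 : ℝ) h (z.prodMk i)
  refine h1.deriv.trans ?_
  rw [show deriv (fun s => G (s, 0)) 0 = _ from h2.deriv,
    show deriv (fun s => G (0, s)) 0 = _ from h3.deriv, ← map_add]
  simp

/-- With `G (s, t) = L(Φ_t(ψ(s)))`, the function being differentiated is the generator of the flow
along `ψ`. The lemma identifies its derivative with the mixed second derivative of `G`, and in
particular supplies its differentiability. -/
theorem hasDerivAt_deriv_snd (hG : ContDiffAt ℝ 2 G 0) :
    HasDerivAt (fun s => deriv (fun t => G (s, t)) 0)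
      (fderiv ℝ (fderiv ℝ G) 0 (1, 0) (0, 1)) 0 := by
  have hev : ∀ᶠ z in 𝓝 ((0 : ℝ), (0 : ℝ)), DifferentiableAt ℝ G z :=
    (ContDiffAt.eventually (x := ((0 : ℝ), (0 : ℝ))) hG (by simp)).mono
      fun y hy => hy.differentiableAt (by simp)
  have hev' : ∀ᶠ s : ℝ in 𝓝 0, DifferentiableAt ℝ G (s, 0) :=
    (by fun_prop : Continuous fun s : ℝ => (s, (0 : ℝ))).continuousAt.eventually hev
  have hmix : (fun s => deriv (fun t => G (s, t)) 0) =ᶠ[𝓝 0]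
      fun s => fderiv ℝ G (s, 0) (0, 1) := by
    filter_upwards [hev'] with s hs
    exact (HasFDerivAt.comp_hasDerivAt (f := fun t : ℝ => (s, t)) (0 : ℝ) hs.hasFDerivAt
      ((hasDerivAt_const _ _).prodMk (hasDerivAt_id _))).deriv
  have hd2 : HasFDerivAt (fderiv ℝ G) (fderiv ℝ (fderiv ℝ G) 0) ((0 : ℝ), (0 : ℝ)) :=
    ((hG.fderiv_right (m := 1) (by norm_num)).differentiableAt (by simp)).hasFDerivAt
  have := (HasFDerivAt.comp_hasDerivAt (f := fun t : ℝ => (t, (0 : ℝ))) (0 : ℝ) hd2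
    ((hasDerivAt_id _).prodMk (hasDerivAt_const _ _))).clm_apply
      (hasDerivAt_const (0 : ℝ) ((0 : ℝ), (1 : ℝ)))
  refine HasDerivAt.congr_of_eventuallyEq ?_ hmix
  simpa using this

/-- The second derivative along a line through `0` is the Hessian evaluated twice on its direction.
Expanding on `(1, 1) = (1, 0) + (0, 1)` yields two cross terms, equal by symmetry of the Hessian. -/
theorem deriv_deriv_diagonal (hG : ContDiffAt ℝ 2 G 0) :
    deriv (deriv fun t => G (t, t)) 0 = deriv (deriv fun s => G (s, 0)) 0 +
      (2 : ℝ) • deriv (fun s => deriv (fun t => G (s, t)) 0) 0 +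
        deriv (deriv fun t => G (0, t)) 0 := by
  have line : ∀ v : ℝ × ℝ, deriv (deriv fun t : ℝ => G (t • v)) 0 =
      fderiv ℝ (fderiv ℝ G) 0 v v := by
    intro v
    have hd : deriv (fun t : ℝ => t • v) = fun _ => v := by
      funext t
      simpa using ((hasDerivAt_id t).smul_const v).deriv
    have := deriv_deriv_comp (f := G) (g := fun t : ℝ => t • v) (t := 0)
      (by simpa using hG) (by fun_prop)
    simpa [hd] using this
  have h1 := line (1, 1)
  have h2 := line (1, 0)
  have h3 := line (0, 1)
  simp only [Prod.smul_mk, smul_eq_mul, mul_one, mul_zero] at h1 h2 h3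
  have hsymm := hG.isSymmSndFDerivAt (by simp) (1, 0) (0, 1)
  rw [h1, h2, h3, (hasDerivAt_deriv_snd hG).deriv, two_smul]
  nth_rewrite 2 [hsymm]
  have e : ((1 : ℝ), (1 : ℝ)) = (1, 0) + (0, 1) := by simp
  rw [e]
  simp only [map_add, add_apply]
  abel

end diagonal

/-! ### Parabolic Taylor coefficients in coordinates -/

section jet

variable {p q : ℕ}

/-- The parabolic Taylor coefficients `(h, n)` of a curve `g(t) = (t h + O(t²), t² n + O(t³))`. -/
def jet (g : ℝ → Coord p q) : Coord p q :=
  ((deriv g 0).1, (1 / 2 : ℝ) • (deriv (deriv g) 0).2)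

theorem jet_congr {g₁ g₂ : ℝ → Coord p q} (h : g₁ =ᶠ[𝓝 0] g₂) : jet g₁ = jet g₂ := by
  simp only [jet, h.deriv_eq, h.deriv.deriv_eq]

theorem hasDerivAt_fst {g : ℝ → Coord p q} {g' : Coord p q} {t : ℝ} (hg : HasDerivAt g g' t) :
    HasDerivAt (fun t => (g t).1) g'.1 t := by
  exact (ContinuousLinearMap.fst ℝ (EuclideanSpace ℝ (Fin p))
    (EuclideanSpace ℝ (Fin q))).hasFDerivAt.comp_hasDerivAt t hg

theorem hasDerivAt_snd {g : ℝ → Coord p q} {g' : Coord p q} {t : ℝ} (hg : HasDerivAt g g' t) :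
    HasDerivAt (fun t => (g t).2) g'.2 t := by
  exact (ContinuousLinearMap.snd ℝ (EuclideanSpace ℝ (Fin p))
    (EuclideanSpace ℝ (Fin q))).hasFDerivAt.comp_hasDerivAt t hg

theorem deriv_snd {g : ℝ → Coord p q} {t : ℝ} (hg : DifferentiableAt ℝ g t) :
    deriv (fun t => (g t).2) t = (deriv g t).2 :=
  (hasDerivAt_snd hg.hasDerivAt).deriv

/-- The inverse parabolic dilations of a curve tangent to the first factor converge to its
parabolic Taylor coefficients. -/
theorem tendsto_jet {g : ℝ → Coord p q} (hg : ContDiffAt ℝ 2 g 0) (h0 : g 0 = 0)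
    (h1 : (deriv g 0).2 = 0) :
    Tendsto (fun t : ℝ => (t⁻¹ • (g t).1, (t⁻¹) ^ 2 • (g t).2)) (𝓝[≠] 0) (𝓝 (jet g)) := by
  have hd : ∀ᶠ s in 𝓝 0, DifferentiableAt ℝ g s :=
    (hg.eventually (by simp)).mono fun y hy => hy.differentiableAt (by simp)
  have hd0 := hd.self_of_nhds
  refine Tendsto.prodMk_nhds ?_ ?_
  · exact tendsto_inv_smul_of_hasDerivAt (hasDerivAt_fst hd0.hasDerivAt) (by simp [h0])
  · have e : deriv (fun t => (g t).2) =ᶠ[𝓝 0] fun t => (deriv g t).2 :=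
      hd.mono fun s hs => deriv_snd hs
    have hd2 : DifferentiableAt ℝ (deriv g) 0 :=
      (contDiffAt_deriv (n := 1) hg (by norm_num)).differentiableAt (by simp)
    have := tendsto_inv_sq_smul (g := fun t => (g t).2) hg.snd (by simp [h0])
      (by rw [deriv_snd hd0, h1])
    rwa [e.deriv_eq, deriv_snd hd2] at this

theorem jet_dilation (v : Coord p q) :
    deriv (fun t : ℝ => ((t • v.1, t ^ 2 • v.2) : Coord p q)) 0 = (v.1, 0) ∧
      jet (fun t : ℝ => ((t • v.1, t ^ 2 • v.2) : Coord p q)) = v := by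
  have h : deriv (fun t : ℝ => ((t • v.1, t ^ 2 • v.2) : Coord p q)) =
      fun t => ((v.1, (2 * t) • v.2) : Coord p q) := by
    funext t
    have := ((hasDerivAt_id t).smul_const v.1).prodMk ((hasDerivAt_pow 2 t).smul_const v.2)
    simpa using this.deriv
  have h2 : deriv (fun t : ℝ => ((v.1, (2 * t) • v.2) : Coord p q)) 0 = (0, (2 : ℝ) • v.2) := by
    have := (hasDerivAt_const (0 : ℝ) v.1).prodMk
      (((hasDerivAt_id (0 : ℝ)).const_mul 2).smul_const v.2)
    simpa using this.deriv
  refine ⟨by rw [h]; simp, ?_⟩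
  rw [jet, h, h2]
  simp [smul_smul]

end jet

theorem two_le_infty : (2 : WithTop ℕ∞) ≤ ∞ :=
  WithTop.coe_le_coe.2 (le_top : (2 : ℕ∞) ≤ ⊤)

/-! ### Arrows in `H`-charts and adapted exponential maps -/

section charts

variable {p q : ℕ} {M : Type*} [TopologicalSpace M]
  [ChartedSpace (EuclideanSpace ℝ (Fin (p + q))) M]

theorem exists_Ioo_subset {s : Set ℝ} (hs : s ∈ 𝓝 (0 : ℝ)) : ∃ ε > 0, Ioo (-ε) ε ⊆ s := by
  obtain ⟨ε, hε, h⟩ := Metric.mem_nhds_iff.1 hs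
  refine ⟨ε, hε, fun t ht => h ?_⟩
  rw [Metric.mem_ball, dist_zero_right, Real.norm_eq_abs]
  exact abs_lt.2 ht

theorem deriv_comp_curve {φ : M → Coord p q} {c : ℝ → M} {t : ℝ}
    (hφ : MDifferentiableAt (𝓡 (p + q)) 𝓘(ℝ, Coord p q) φ (c t))
    (hc : MDifferentiableAt 𝓘(ℝ, ℝ) (𝓡 (p + q)) c t) :
    deriv (fun s => φ (c s)) t =
      mfderiv (𝓡 (p + q)) 𝓘(ℝ, Coord p q) φ (c t)
        (mfderiv 𝓘(ℝ, ℝ) (𝓡 (p + q)) c t (1 : ℝ)) := by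
  have key := mfderiv_comp_apply t hφ hc (1 : ℝ)
  rw [mfderiv_eq_fderiv] at key
  exact key

variable [IsManifold (𝓡 (p + q)) ∞ M] {H : TangentDistribution p q M} {m : M}
  {φ φ' : OpenPartialHomeomorph M (Coord p q)} {c : ℝ → M}

theorem IsHCurve.contMDiffAt (hc : IsHCurve H m c) :
    ContMDiffAt 𝓘(ℝ, ℝ) (𝓡 (p + q)) ∞ c 0 := by
  obtain ⟨ε, hε, h⟩ := hc.smooth
  exact h.contMDiffAt (Ioo_mem_nhds (by linarith) hε)

theorem IsHChart.contMDiffAt (hφ : IsHChart H m φ) :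
    ContMDiffAt (𝓡 (p + q)) 𝓘(ℝ, Coord p q) ∞ φ m :=
  hφ.smooth.contMDiffAt (φ.open_source.mem_nhds hφ.mem_source)

theorem IsHChart.contDiffAt_comp (hφ : IsHChart H m φ) (hc : IsHCurve H m c) :
    ContDiffAt ℝ ∞ (fun t => φ (c t)) 0 := by
  rw [← contMDiffAt_iff_contDiffAt]
  refine ContMDiffAt.comp (g := φ) (0 : ℝ) ?_ hc.contMDiffAt
  rw [hc.base]
  exact hφ.contMDiffAt

theorem IsHChart.apply_curve_zero (hφ : IsHChart H m φ) (hc : IsHCurve H m c) :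
    φ (c 0) = 0 := by
  rw [hc.base, hφ.map_base]

/-- By the chain rule, tangency to `H` at `m` becomes the vanishing of the normal part of the
coordinate velocity. -/
theorem IsHChart.tangent_iff (hφ : IsHChart H m φ) (h0 : c 0 = m)
    (hc : MDifferentiableAt 𝓘(ℝ, ℝ) (𝓡 (p + q)) c 0) :
    mfderiv 𝓘(ℝ, ℝ) (𝓡 (p + q)) c 0 (1 : ℝ) ∈ H.fiber (c 0) ↔
      (deriv (fun t => φ (c t)) 0).2 = 0 := by
  subst h0
  rw [deriv_comp_curve (hφ.contMDiffAt.mdifferentiableAt (by simp)) hc]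
  exact hφ.mem_fiber_iff _

theorem IsHChart.deriv_snd (hφ : IsHChart H m φ) (hc : IsHCurve H m c) :
    (deriv (fun t => φ (c t)) 0).2 = 0 :=
  (hφ.tangent_iff hc.base (hc.contMDiffAt.mdifferentiableAt (by simp))).1 hc.tangent

theorem IsHChart.symm_comp_eventually (hφ : IsHChart H m φ) {g : ℝ → Coord p q}
    (hg : ContinuousAt g 0) (h0 : g 0 = 0) : ∀ᶠ t in 𝓝 0, φ (φ.symm (g t)) = g t := by
  have h : φ.target ∈ 𝓝 (g 0) := by
    rw [h0, ← hφ.map_base]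
    exact φ.open_target.mem_nhds (φ.map_source hφ.mem_source)
  filter_upwards [hg h] with t ht
  exact φ.right_inv ht

theorem IsHChart.isHCurve_symm_comp (hφ : IsHChart H m φ) {g : ℝ → Coord p q}
    (hg : ContDiff ℝ ∞ g) (h0 : g 0 = 0) (h1 : (deriv g 0).2 = 0) :
    IsHCurve H m (fun t => φ.symm (g t)) := by
  have hz : φ.symm (g 0) = m := by rw [h0, ← hφ.map_base, φ.left_inv hφ.mem_source]
  have hmem : g ⁻¹' φ.target ∈ 𝓝 (0 : ℝ) := by
    refine hg.continuous.continuousAt (φ.open_target.mem_nhds ?_)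
    rw [h0, ← hφ.map_base]
    exact φ.map_source hφ.mem_source
  obtain ⟨ε, hε, hsub⟩ := exists_Ioo_subset hmem
  have hs : ContMDiffOn 𝓘(ℝ, ℝ) (𝓡 (p + q)) ∞ (fun t => φ.symm (g t)) (Ioo (-ε) ε) :=
    hφ.smooth_symm.comp hg.contMDiff.contMDiffOn hsub
  refine ⟨hz, ⟨ε, hε, hs⟩, ?_⟩
  refine (hφ.tangent_iff (c := fun t => φ.symm (g t)) hz ((hs.contMDiffAt
    (Ioo_mem_nhds (by linarith) hε)).mdifferentiableAt (by simp))).2 ?_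
  have e : (fun t => φ (φ.symm (g t))) =ᶠ[𝓝 0] g :=
    hφ.symm_comp_eventually hg.continuous.continuousAt h0
  rw [e.deriv_eq, h1]

/-- The equivalence of curves may be tested in a single `H`-chart. -/
theorem IsHChart.hEquiv_iff (hφ : IsHChart H m φ) {c₁ c₂ : ℝ → M} (h₁ : IsHCurve H m c₁)
    (h₂ : IsHCurve H m c₂) :
    HEquiv H m c₁ c₂ ↔ jet (fun t => φ (c₁ t)) = jet (fun t => φ (c₂ t)) := by
  constructor
  · intro h
    obtain ⟨e1, e2⟩ := h φ hφ
    simp only [iteratedDeriv_succ, iteratedDeriv_zero, Prod.snd_sub] at e2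
    simp only [jet, e1, sub_eq_zero.1 e2]
  · intro h φ' hφ'
    set f : Coord p q → Coord p q := fun z => φ' (φ.symm z) with hf
    have hsymm0 : φ.symm 0 = m := by rw [← hφ.map_base, φ.left_inv hφ.mem_source]
    have hfs : ContDiffAt ℝ ∞ f 0 := by
      rw [← contMDiffAt_iff_contDiffAt]
      refine ContMDiffAt.comp (I' := 𝓡 (p + q)) (g := φ') (f := φ.symm) (0 : Coord p q) ?_ ?_
      · rw [hsymm0]; exact hφ'.contMDiffAt
      · refine hφ.smooth_symm.contMDiffAt (φ.open_target.mem_nhds ?_)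
        rw [← hφ.map_base]
        exact φ.map_source hφ.mem_source
    -- The derivative of the chart change preserves `ℝ^p × 0`: a straight line in this direction is
    -- a curve tangent to `H`, and its velocity in the other chart again has zero normal part.
    have hD : ∀ w : Coord p q, w.2 = 0 → (fderiv ℝ f 0 w).2 = 0 := by
      intro w hw
      have hl : HasDerivAt (fun t : ℝ => t • w) w 0 := by
        simpa using (hasDerivAt_id (0 : ℝ)).smul_const w
      have hcur := hφ.isHCurve_symm_comp (g := fun t : ℝ => t • w) (by fun_prop) (by simp)
        (by rw [hl.deriv, hw])
      have := hφ'.deriv_snd hcur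
      have h2 : HasFDerivAt f (fderiv ℝ f 0) ((0 : ℝ) • w) := by
        rw [zero_smul]
        exact (hfs.differentiableAt (by simp)).hasFDerivAt
      have h3 : deriv (fun t : ℝ => φ' (φ.symm (t • w))) 0 = fderiv ℝ f 0 w :=
        (h2.comp_hasDerivAt (f := fun t : ℝ => t • w) (0 : ℝ) hl).deriv
      rwa [h3] at this
    have hcomp : ∀ c, IsHCurve H m c →
        deriv (fun t => φ' (c t)) 0 = fderiv ℝ f 0 (deriv (fun t => φ (c t)) 0) ∧
        deriv (deriv fun t => φ' (c t)) 0 =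
          fderiv ℝ (fderiv ℝ f) 0 (deriv (fun t => φ (c t)) 0) (deriv (fun t => φ (c t)) 0) +
            fderiv ℝ f 0 (deriv (deriv fun t => φ (c t)) 0) := by
      intro c hc
      have e : (fun t => φ' (c t)) =ᶠ[𝓝 0] fun t => f (φ (c t)) := by
        have hsrc : φ.source ∈ 𝓝 (c 0) := by
          rw [hc.base]; exact φ.open_source.mem_nhds hφ.mem_source
        filter_upwards [hc.contMDiffAt.continuousAt hsrc] with t ht
        simp only [hf]
        rw [φ.left_inv ht]
      have hg := hφ.contDiffAt_comp hc
      have hg0 := hφ.apply_curve_zero hc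
      rw [e.deriv_eq, e.deriv.deriv_eq]
      constructor
      · have h2 : HasFDerivAt f (fderiv ℝ f 0) (φ (c 0)) := by
          rw [hg0]
          exact (hfs.differentiableAt (by simp)).hasFDerivAt
        exact (h2.comp_hasDerivAt (0 : ℝ) (hg.differentiableAt (by simp)).hasDerivAt).deriv
      · have := deriv_deriv_comp (f := f) (g := fun t => φ (c t)) (t := 0)
          (by rw [hg0]; exact hfs.of_le two_le_infty)
          (hg.of_le two_le_infty)
        rwa [hg0] at this
    obtain ⟨a1, a2⟩ := hcomp c₁ h₁
    obtain ⟨b1, b2⟩ := hcomp c₂ h₂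
    -- The jet records only the `H`-part of the velocity; the normal part vanishes for both curves
    -- by tangency.
    have e1 : deriv (fun t => φ (c₁ t)) 0 = deriv (fun t => φ (c₂ t)) 0 :=
      Prod.ext (show (jet _).1 = (jet _).1 from congrArg Prod.fst h)
        (by rw [hφ.deriv_snd h₁, hφ.deriv_snd h₂])
    have e2 : (deriv (deriv fun t => φ (c₁ t)) 0 - deriv (deriv fun t => φ (c₂ t)) 0).2 = 0 := by
      have := congrArg Prod.snd h
      simp only [jet] at this
      rw [Prod.snd_sub, sub_eq_zero]
      exact smul_right_injective _ (by norm_num : (1 / 2 : ℝ) ≠ 0) this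
    refine ⟨by rw [a1, b1, e1], ?_⟩
    simp only [iteratedDeriv_succ, iteratedDeriv_zero]
    -- The quadratic terms depend only on the common velocity and cancel. What remains is the
    -- derivative of the chart change applied to a vector of `H_m`.
    rw [a2, b2, e1, add_sub_add_left_eq_sub, ← map_sub]
    exact hD _ e2

/-- The coordinates `(h, n)` of parabolic arrows at `m` in an `H`-chart. -/
def IsHChart.coords (hφ : IsHChart H m φ) : Arrow H m → Coord p q :=
  Quotient.lift (fun c => jet (fun t => φ (c.1 t)))
    (fun c₁ c₂ h => (hφ.hEquiv_iff c₁.2 c₂.2).1 h)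

theorem IsHChart.coords_arrow (hφ : IsHChart H m φ) (hc : IsHCurve H m c) :
    hφ.coords (arrow hc) = jet (fun t => φ (c t)) := rfl

theorem IsHChart.coords_injective (hφ : IsHChart H m φ) : Function.Injective hφ.coords := by
  intro u v
  refine Quotient.inductionOn₂ u v fun c₁ c₂ h => ?_
  exact Quotient.sound ((hφ.hEquiv_iff c₁.2 c₂.2).2 h)

theorem IsHChart.coords_surjective (hφ : IsHChart H m φ) : Function.Surjective hφ.coords := by
  intro v
  obtain ⟨h1, h2⟩ := jet_dilation v
  have hg : ContDiff ℝ ∞ (fun t : ℝ => ((t • v.1, t ^ 2 • v.2) : Coord p q)) := by fun_prop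
  have h0 : (fun t : ℝ => ((t • v.1, t ^ 2 • v.2) : Coord p q)) 0 = 0 := by simp
  refine ⟨arrow (hφ.isHCurve_symm_comp hg h0 (by rw [h1])), ?_⟩
  rw [hφ.coords_arrow]
  exact (jet_congr (hφ.symm_comp_eventually hg.continuous.continuousAt h0)).trans h2

/-- Arrow coordinates in an `H`-chart, as a bijection. -/
def IsHChart.coordsEquiv (hφ : IsHChart H m φ) : Arrow H m ≃ Coord p q :=
  Equiv.ofBijective hφ.coords ⟨hφ.coords_injective, hφ.coords_surjective⟩

/-- The parabolic limit of a curve in an `H`-chart is given by the coordinates of its arrow. -/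
theorem IsHChart.tendsto_coords (hφ : IsHChart H m φ) (hc : IsHCurve H m c) :
    Tendsto (fun t : ℝ => (t⁻¹ • (φ (c t)).1, (t⁻¹) ^ 2 • (φ (c t)).2)) (𝓝[≠] 0)
      (𝓝 (hφ.coords (arrow hc))) :=
  tendsto_jet ((hφ.contDiffAt_comp hc).of_le two_le_infty)
    (hφ.apply_curve_zero hc) (hφ.deriv_snd hc)

variable (E : HCoordSystem H) {x : M}

/-- The `H`-chart at `x` with inverse `E_x`. -/
def HCoordSystem.chart (hx : x ∈ E.dom) : OpenPartialHomeomorph M (Coord p q) :=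
  (E.exists_chart x hx).choose

theorem HCoordSystem.isHChart (hx : x ∈ E.dom) : IsHChart H x (E.chart hx) :=
  (E.exists_chart x hx).choose_spec.1

theorem HCoordSystem.chart_target (hx : x ∈ E.dom) : (E.chart hx).target = univ :=
  (E.exists_chart x hx).choose_spec.2.1

theorem HCoordSystem.toFun_eq (hx : x ∈ E.dom) (v : Coord p q) :
    E.toFun x v = (E.chart hx).symm v :=
  (E.exists_chart x hx).choose_spec.2.2 v

theorem HCoordSystem.chart_toFun (hx : x ∈ E.dom) (v : Coord p q) :
    E.chart hx (E.toFun x v) = v := by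
  rw [E.toFun_eq hx, (E.chart hx).right_inv (by rw [E.chart_target]; trivial)]

theorem HCoordSystem.coords_taylor (hx : x ∈ E.dom) (v : Coord p q) :
    (E.isHChart hx).coords (E.taylor x v) = v := by
  rw [HCoordSystem.taylor, dif_pos hx, IsHChart.coords_arrow]
  simp only [E.chart_toFun hx]
  exact (jet_dilation v).2

theorem HCoordSystem.taylor_coords (hx : x ∈ E.dom) (v : Arrow H x) :
    E.taylor x ((E.isHChart hx).coords v) = v :=
  (E.isHChart hx).coords_injective (E.coords_taylor hx _)

/-- In Taylor coordinates the dilation acts by weights `1` and `2`, because `(st, (st)²)` splits as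
`(t · s, t² · s²)` along the defining curve. -/
theorem HCoordSystem.dilate_taylor (hx : x ∈ E.dom) (s : ℝ) (v : Coord p q) :
    (E.taylor x v).dilate s = E.taylor x (s • v.1, s ^ 2 • v.2) := by
  rw [HCoordSystem.taylor, HCoordSystem.taylor, dif_pos hx, dif_pos hx]
  have : (fun t : ℝ => E.toFun x ((s * t) • v.1, (s * t) ^ 2 • v.2)) =
      fun t => E.toFun x (t • s • v.1, t ^ 2 • s ^ 2 • v.2) := by
    funext t
    simp only [smul_smul, mul_comm s t, mul_pow]
  change arrow ((E.isHCurve hx v).rescale s) = _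
  simp only [arrow, this]
  rfl

open Classical in
/-- The `H`-adapted exponential map `F_x(v) ↦ E_x(v)` defined by a system of `H`-coordinates. -/
def HCoordSystem.adaptedExp : HAdaptedExp H where
  dom := E.dom
  isOpen_dom := E.isOpen_dom
  toFun x v := if hx : x ∈ E.dom then E.toFun x ((E.isHChart hx).coords v) else x
  smooth x hx := by
    refine ⟨E, hx, ?_⟩
    rw [inter_self]
    refine E.smooth.congr fun z hz => ?_
    rw [dif_pos hz.1, E.coords_taylor hz.1]
  adapted x hx v := by
    have h : (fun t : ℝ => if hx : x ∈ E.dom then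
        E.toFun x ((E.isHChart hx).coords (v.dilate t)) else x) =
        fun t => E.toFun x (t • ((E.isHChart hx).coords v).1,
          t ^ 2 • ((E.isHChart hx).coords v).2) := by
      funext t
      rw [dif_pos hx]
      nth_rewrite 1 [← E.taylor_coords hx v]
      rw [E.dilate_taylor hx, E.coords_taylor hx]
    rw [h]
    refine ⟨E.isHCurve hx _, ?_⟩
    refine Eq.trans ?_ (E.taylor_coords hx v)
    rw [HCoordSystem.taylor, dif_pos hx]

theorem HCoordSystem.adaptedExp_taylor (hx : x ∈ E.dom) (v : Coord p q) :
    E.adaptedExp.toFun x (E.taylor x v) = E.toFun x v := by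
  simp only [HCoordSystem.adaptedExp]
  rw [dif_pos hx, E.coords_taylor hx]

end charts

/-! ### Charts with a frame adapted to `H` -/

section frame

variable {p q : ℕ}

/-- The linear map `h ↦ ∑ hᵢ wᵢ`. -/
def frameMap {F : Type*} [NormedAddCommGroup F] [NormedSpace ℝ F] (w : Fin p → F) :
    EuclideanSpace ℝ (Fin p) →L[ℝ] F :=
  ∑ i, (EuclideanSpace.proj i : EuclideanSpace ℝ (Fin p) →L[ℝ] ℝ).smulRight (w i)

theorem frameMap_apply {F : Type*} [NormedAddCommGroup F] [NormedSpace ℝ F] (w : Fin p → F)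
    (h : EuclideanSpace ℝ (Fin p)) : frameMap w h = ∑ i, h i • w i := by
  simp [frameMap]

/-- The span of `w` has dimension `p`, so any complement has dimension `q` and can be parametrized
by the second factor. -/
theorem exists_equiv_of_linearIndependent {F : Type*} [NormedAddCommGroup F] [NormedSpace ℝ F]
    [FiniteDimensional ℝ F] (hF : Module.finrank ℝ F = p + q) {w : Fin p → F}
    (hw : LinearIndependent ℝ w) :
    ∃ B : Coord p q ≃L[ℝ] F, ∀ h, B (h, 0) = frameMap w h := by
  set T : EuclideanSpace ℝ (Fin p) →ₗ[ℝ] F := (frameMap w).toLinearMap with hT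
  have hinj : Function.Injective T := by
    rw [← LinearMap.ker_eq_bot, LinearMap.ker_eq_bot']
    intro h hh
    ext i
    exact Fintype.linearIndependent_iff.1 hw _ ((frameMap_apply w h).symm.trans hh) i
  obtain ⟨S, hS⟩ := Submodule.exists_isCompl (LinearMap.range T)
  have h1 := LinearMap.finrank_range_of_inj hinj
  have h2 := Submodule.finrank_add_eq_of_isCompl hS
  rw [finrank_euclideanSpace_fin] at h1
  have h3 : Module.finrank ℝ (EuclideanSpace ℝ (Fin q)) = Module.finrank ℝ S := by
    rw [finrank_euclideanSpace_fin]; omega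
  let e : Coord p q ≃ₗ[ℝ] F :=
    (LinearEquiv.prodCongr (LinearEquiv.ofInjective T hinj) (LinearEquiv.ofFinrankEq _ _ h3)).trans
      (Submodule.prodEquivOfIsCompl _ _ hS)
  refine ⟨e.toContinuousLinearEquiv, fun h => ?_⟩
  simp [e, hT]

variable {M : Type*} [TopologicalSpace M]
  [ChartedSpace (EuclideanSpace ℝ (Fin (p + q))) M] [IsManifold (𝓡 (p + q)) ∞ M]

/-- A chart at `m` together with a smooth frame `A` of the tangent bundle near `m`, adapted to `H`
and equal to the coordinate frame at `m`. -/
structure AdaptedFrame (H : TangentDistribution p q M) (m : M) where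
  /-- The chart. -/
  chart : OpenPartialHomeomorph M (Coord p q)
  mem_source : m ∈ chart.source
  map_base : chart m = 0
  smooth : ContMDiffOn (𝓡 (p + q)) 𝓘(ℝ, Coord p q) ∞ chart chart.source
  smooth_symm : ContMDiffOn 𝓘(ℝ, Coord p q) (𝓡 (p + q)) ∞ chart.symm chart.target
  /-- The radius of the domain of the frame. -/
  radius : ℝ
  radius_pos : 0 < radius
  ball_subset : Metric.ball 0 (2 * radius) ⊆ chart.target
  /-- The frame. -/
  frame : Coord p q → Coord p q ≃L[ℝ] Coord p q
  frame_zero : frame 0 = ContinuousLinearEquiv.refl ℝ (Coord p q)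
  smooth_frame : ContDiffOn ℝ ∞ (fun z => (frame z : Coord p q →L[ℝ] Coord p q))
    (Metric.ball 0 radius)
  mem_fiber_iff : ∀ x ∈ chart.source, chart x ∈ Metric.ball 0 radius →
    ∀ v : TangentSpace (𝓡 (p + q)) x, v ∈ H.fiber x ↔
      ((frame (chart x)).symm (mfderiv (𝓡 (p + q)) 𝓘(ℝ, Coord p q) chart x v)).2 = 0

/-- An affine change of a given chart turns the spanning fields at `m` into the first `p` coordinate
vectors. Keeping the last `q` coordinate vectors constant completes the fields to a family that is
the identity at `0`, hence still invertible nearby. -/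
theorem exists_adaptedFrame (H : TangentDistribution p q M) (m : M) :
    Nonempty (AdaptedFrame H m) := by
  obtain ⟨U, hU, hmU, X, hX, hspan⟩ := H.exists_frame m
  let V := EuclideanSpace ℝ (Fin (p + q))
  let χ := chartAt V m
  have hmχ : m ∈ χ.source := mem_chart_source V m
  let D : ∀ y : M, TangentSpace (𝓡 (p + q)) y →L[ℝ] V := fun y =>
    mfderiv (𝓡 (p + q)) 𝓘(ℝ, V) (extChartAt (𝓡 (p + q)) m) y
  have hDinj : ∀ y ∈ χ.source, Function.Injective (D y) := fun y hy =>
    (isInvertible_mfderiv_extChartAt (by simpa using hy)).injective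
  have hW : ∀ i, ContMDiffOn (𝓡 (p + q)) 𝓘(ℝ, V) ∞ (fun y => D y (X i y)) (U ∩ χ.source) := by
    intro i
    have h1 := ((trivializationAt V (TangentSpace (𝓡 (p + q))) m).contMDiffOn_section_iff
      (IB := 𝓡 (p + q)) (n := ∞) (s := X i) (a := U ∩ χ.source) (hU.inter χ.open_source)
      (fun y hy => hy.2)).1
      ((hX i).mono inter_subset_left)
    -- The trivialization of `TM` over the chart is the derivative of that chart, so smoothness of
    -- the section is smoothness of its chart representative.
    refine h1.congr fun y hy => ?_
    simp only [D]
    rw [← TangentBundle.continuousLinearMapAt_trivializationAt hy.2]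
    rw [Bundle.Trivialization.continuousLinearMapAt_apply, Bundle.Trivialization.linearMapAt_apply]
    exact if_pos hy.2
  have hli : LinearIndependent ℝ (fun i => D m (X i m)) :=
    (hspan m hmU).1.map' (D m).toLinearMap (LinearMap.ker_eq_bot.2 (hDinj m hmχ))
  obtain ⟨B, hB⟩ := exists_equiv_of_linearIndependent (p := p) (q := q) (F := V)
    (by simp [V]) hli
  let L : OpenPartialHomeomorph M (Coord p q) :=
    χ.transHomeomorph ((Homeomorph.subRight (χ m)).trans B.symm.toHomeomorph)
  have hLapp : ∀ y, L y = B.symm (χ y - χ m) := fun y => rfl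
  have haff : ContDiff ℝ ∞ (fun z : V => B.symm (z - χ m)) := by fun_prop
  have haff' : ContDiff ℝ ∞ (fun z : Coord p q => B z + χ m) := by fun_prop
  have hLm : L m = 0 := by rw [hLapp]; simp
  have hsmooth : ContMDiffOn (𝓡 (p + q)) 𝓘(ℝ, Coord p q) ∞ L L.source :=
    haff.contMDiff.comp_contMDiffOn (contMDiffOn_chart (x := m))
  have hsmooth' : ContMDiffOn 𝓘(ℝ, Coord p q) (𝓡 (p + q)) ∞ L.symm L.target :=
    (contMDiffOn_chart_symm (x := m)).comp haff'.contMDiff.contMDiffOn (fun z hz => hz)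
  have hLD : ∀ y ∈ L.source, ∀ v,
      mfderiv (𝓡 (p + q)) 𝓘(ℝ, Coord p q) L y v = B.symm (D y v) := by
    intro y hy v
    have h1 : MDifferentiableAt (𝓡 (p + q)) 𝓘(ℝ, V) (extChartAt (𝓡 (p + q)) m) y :=
      mdifferentiableAt_extChartAt hy
    have h2 := mfderiv_comp_apply (I'' := 𝓘(ℝ, Coord p q)) y
      (haff.contMDiff.mdifferentiableAt (x := extChartAt (𝓡 (p + q)) m y) (by simp)) h1 v
    have h3 : fderiv ℝ (fun z : V => B.symm (z - χ m)) (extChartAt (𝓡 (p + q)) m y) =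
        (B.symm : V →L[ℝ] Coord p q) :=
      (B.symm.hasFDerivAt.comp _ ((hasFDerivAt_id _).sub_const _)).fderiv
    rw [mfderiv_eq_fderiv, h3] at h2
    exact h2
  let Z : Fin p → Coord p q → Coord p q := fun i z =>
    B.symm (D (L.symm z) (X i (L.symm z)))
  let O : Set (Coord p q) := L.target ∩ L.symm ⁻¹' U
  have hO : IsOpen O := L.isOpen_inter_preimage_symm hU
  have hL0 : L.symm 0 = m := by rw [← hLm]; exact L.left_inv hmχ
  have h0O : (0 : Coord p q) ∈ O := by
    refine ⟨?_, by rwa [mem_preimage, hL0]⟩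
    rw [← hLm]
    exact L.map_source hmχ
  have hZ : ∀ i, ContDiffOn ℝ ∞ (Z i) O := by
    intro i
    rw [← contMDiffOn_iff_contDiffOn]
    have h1 := (hW i).comp (hsmooth'.mono (inter_subset_left : O ⊆ _))
      (fun z hz => ⟨hz.2, L.map_target hz.1⟩)
    exact B.symm.contDiff.contMDiff.comp_contMDiffOn h1
  let A : Coord p q → Coord p q →L[ℝ] Coord p q := fun z =>
    (frameMap fun i => Z i z).comp (ContinuousLinearMap.fst ℝ _ _) +
      (ContinuousLinearMap.inr ℝ _ _).comp (ContinuousLinearMap.snd ℝ _ _)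
  have hAs : ContDiffOn ℝ ∞ A O := by
    refine ContDiffOn.add (ContDiffOn.clm_comp ?_ contDiffOn_const) contDiffOn_const
    refine ContDiffOn.sum fun i _ => ?_
    exact contDiffOn_const.smulRight (hZ i)
  have hA0 : A 0 = ContinuousLinearEquiv.refl ℝ (Coord p q) := by
    refine ContinuousLinearMap.ext fun v => ?_
    have h1 : frameMap (fun i => Z i 0) v.1 = (v.1, 0) := by
      rw [← B.injective.eq_iff, hB, frameMap_apply, frameMap_apply, map_sum]
      refine Finset.sum_congr rfl fun i _ => ?_
      simp only [Z]
      rw [map_smul, B.apply_symm_apply, hL0]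
    simp [A, h1]
  let S : Set (Coord p q) := O ∩ A ⁻¹' range
    ((↑) : (Coord p q ≃L[ℝ] Coord p q) → Coord p q →L[ℝ] Coord p q)
  have hS : IsOpen S := hAs.continuousOn.isOpen_inter_preimage hO ContinuousLinearEquiv.isOpen
  have h0S : (0 : Coord p q) ∈ S := ⟨h0O, ⟨_, hA0.symm⟩⟩
  obtain ⟨r, hr, hball⟩ := Metric.isOpen_iff.1 hS 0 h0S
  have hsub : Metric.ball (0 : Coord p q) (r / 2) ⊆ S :=
    (Metric.ball_subset_ball (by linarith)).trans hball
  -- Away from the set where `A z` is invertible the frame takes the identity as a dummy value.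
  have hch : ∀ z, ∃ e : Coord p q ≃L[ℝ] Coord p q, z ∈ S →
      (e : Coord p q →L[ℝ] Coord p q) = A z := by
    intro z
    by_cases hz : z ∈ S
    · obtain ⟨e, he⟩ := hz.2
      exact ⟨e, fun _ => he⟩
    · exact ⟨ContinuousLinearEquiv.refl ℝ _, fun h => absurd h hz⟩
  choose e he using hch
  refine ⟨⟨L, hmχ, hLm, hsmooth, hsmooth', r / 2, by linarith, ?_, e, ?_, ?_, ?_⟩⟩
  · rw [show 2 * (r / 2) = r by ring]
    exact fun z hz => (hball hz).1.1
  · exact ContinuousLinearEquiv.coe_injective ((he 0 h0S).trans hA0)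
  · exact (hAs.mono fun z hz => (hsub hz).1).congr fun z hz => he z (hsub hz)
  · intro x hx hxb v
    have hxS := hsub hxb
    have hxU : x ∈ U := by
      have := hxS.1.2
      rwa [mem_preimage, L.left_inv hx] at this
    have hDi : Function.Injective (fun v => B.symm (D x v)) :=
      B.symm.injective.comp (hDinj x hx)
    have hAv : ∀ h : EuclideanSpace ℝ (Fin p),
        e (L x) (h, 0) = B.symm (D x (∑ i, h i • X i x)) := by
      intro h
      have h1 : e (L x) (h, 0) = A (L x) (h, 0) := by rw [← he _ hxS]; rfl
      rw [h1]
      have h2 : A (L x) (h, 0) = frameMap (fun i => Z i (L x)) h := by simp [A]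
      rw [h2, frameMap_apply, map_sum, map_sum]
      refine Finset.sum_congr rfl fun i _ => ?_
      simp only [Z]
      rw [L.left_inv hx, map_smul, map_smul]
    rw [hLD x hx, ← (hspan x hxU).2]
    constructor
    · intro hv
      obtain ⟨c, rfl⟩ := (Submodule.mem_span_range_iff_exists_fun ℝ).1 hv
      have := hAv (WithLp.toLp 2 c)
      exact congrArg Prod.snd ((e (L x)).symm_apply_eq.2 this.symm)
    · intro hv
      set w := (e (L x)).symm (B.symm (D x v)) with hw
      have h1 : e (L x) (w.1, 0) = B.symm (D x v) := by
        rw [← hv, hw, Prod.mk.eta, (e (L x)).apply_symm_apply]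
      rw [hAv] at h1
      rw [← hDi h1]
      exact Submodule.sum_mem _ fun i _ => Submodule.smul_mem _ _
        (Submodule.subset_span (mem_range_self i))

end frame

/-! ### Smooth systems of `H`-coordinates defined on all of `ℝ^p × ℝ^q` -/

section coordinates

variable {p q : ℕ}

/-- A diffeomorphism from the coordinate space onto a neighbourhood of `0` inside a given ball,
whose inverse is of the form `w ↦ s(w) w` with `s` continuous at `0` and `s(0) = 1`. -/
theorem exists_diffeomorph_into_ball {r : ℝ} (hr : 0 < r) :
    ∃ σ : OpenPartialHomeomorph (Coord p q) (Coord p q), σ.source = univ ∧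
      σ.target ⊆ Metric.ball 0 r ∧ σ 0 = 0 ∧ ContDiff ℝ ∞ σ ∧ ContDiffOn ℝ ∞ σ.symm σ.target ∧
      ∃ s : Coord p q → ℝ, ContinuousAt s 0 ∧ s 0 = 1 ∧ ∀ w, σ.symm w = s w • w := by
  have hdim : Module.finrank ℝ (Coord p q) =
      Module.finrank ℝ (EuclideanSpace ℝ (Fin (p + q))) := by simp
  -- The norm of the product is a maximum, hence not smooth; the standard diffeomorphism onto the
  -- unit ball is therefore transported from a Euclidean space.
  let B : Coord p q ≃L[ℝ] EuclideanSpace ℝ (Fin (p + q)) :=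
    ContinuousLinearEquiv.ofFinrankEq hdim
  let K : ℝ := ‖(B.symm : EuclideanSpace ℝ (Fin (p + q)) →L[ℝ] Coord p q)‖
  have hK : 0 ≤ K := norm_nonneg _
  -- Since `‖w‖ ≤ K ‖B w‖`, this scale puts the preimage of the unit ball inside the ball of radius
  -- `r`; the summand `1` covers `K = 0`.
  let c : ℝ := (K + 1) / r
  have hc : 0 < c := by positivity
  let h : Coord p q ≃ₜ EuclideanSpace ℝ (Fin (p + q)) :=
    B.toHomeomorph.trans (Homeomorph.smulOfNeZero c hc.ne')
  have happ : ∀ v, h v = c • B v := fun v => rfl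
  have hsymm : ∀ w, h.symm w = B.symm (c⁻¹ • w) := fun w => rfl
  have hs : ContDiff ℝ ∞ h := by
    change ContDiff ℝ ∞ (fun v => c • B v)
    fun_prop
  have hs' : ContDiff ℝ ∞ h.symm := by
    change ContDiff ℝ ∞ (fun w => B.symm (c⁻¹ • w))
    fun_prop
  let σ : OpenPartialHomeomorph (Coord p q) (Coord p q) :=
    (h.transOpenPartialHomeomorph OpenPartialHomeomorph.univUnitBall).transHomeomorph h.symm
  have hσ : ∀ v, σ v = h.symm (OpenPartialHomeomorph.univUnitBall (h v)) := fun v => rfl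
  have hσs : ∀ w, σ.symm w = h.symm (OpenPartialHomeomorph.univUnitBall.symm (h w)) :=
    fun w => rfl
  have htarget : ∀ w ∈ σ.target, h w ∈ Metric.ball (0 : EuclideanSpace ℝ (Fin (p + q))) 1 :=
    fun w hw => hw
  refine ⟨σ, rfl, fun w hw => ?_, ?_, ?_, ?_, fun w => (√(1 - ‖h w‖ ^ 2))⁻¹, ?_, ?_, fun w => ?_⟩
  · have h1 := htarget w hw
    rw [mem_ball_zero_iff, happ, norm_smul, Real.norm_eq_abs, abs_of_pos hc] at h1
    rw [mem_ball_zero_iff]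
    have h2 : ‖w‖ ≤ K * ‖B w‖ := by
      simpa using (B.symm : EuclideanSpace ℝ (Fin (p + q)) →L[ℝ] Coord p q).le_opNorm (B w)
    have h3 : (K + 1) * ‖B w‖ < r := by
      have : c * ‖B w‖ = (K + 1) * ‖B w‖ / r := by ring
      rw [this, div_lt_one hr] at h1
      exact h1
    nlinarith [norm_nonneg (B w)]
  · rw [hσ, hsymm, happ]
    simp
  · exact hs'.comp ((OpenPartialHomeomorph.contDiff_univUnitBall (n := ⊤)).comp hs)
  · exact hs'.comp_contDiffOn
      ((OpenPartialHomeomorph.contDiffOn_univUnitBall_symm (n := ⊤)).comp hs.contDiffOn htarget)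
  · refine ContinuousAt.inv₀ ?_ ?_
    · exact (Real.continuous_sqrt.comp
        (continuous_const.sub ((h.continuous.norm).pow 2))).continuousAt
    · simp [happ]
  · simp [happ]
  · rw [hσs, hsymm, OpenPartialHomeomorph.univUnitBall_symm_apply, smul_smul, map_smul]
    nth_rewrite 2 [happ]
    rw [map_smul, B.symm_apply_apply, smul_smul]
    congr 1
    field_simp

/-- The remainder is `(s w - 1) • w = o(w)`, so continuity of `s` at `0` suffices. -/
theorem hasFDerivAt_smul_self {E : Type*} [NormedAddCommGroup E] [NormedSpace ℝ E] {s : E → ℝ}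
    (hs : ContinuousAt s 0) (h0 : s 0 = 1) :
    HasFDerivAt (fun w => s w • w) (ContinuousLinearMap.id ℝ E) 0 := by
  rw [hasFDerivAt_iff_isLittleO_nhds_zero]
  have h1 : (fun w => s w - 1) =o[𝓝 0] (fun _ : E => (1 : ℝ)) := by
    rw [Asymptotics.isLittleO_one_iff]
    have h2 : Tendsto s (𝓝 0) (𝓝 (s 0)) := hs
    simpa [h0] using h2.sub_const 1
  have h2 := h1.smul_isBigO (Asymptotics.isBigO_refl (fun w : E => w) (𝓝 0))
  simpa [sub_smul] using h2

variable {M : Type*} [TopologicalSpace M]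
  [ChartedSpace (EuclideanSpace ℝ (Fin (p + q))) M] [IsManifold (𝓡 (p + q)) ∞ M]
  {H : TangentDistribution p q M} {m : M} (f : AdaptedFrame H m)

namespace AdaptedFrame

theorem zero_mem_ball : (0 : Coord p q) ∈ Metric.ball (0 : Coord p q) f.radius :=
  Metric.mem_ball_self f.radius_pos

theorem isHChart : IsHChart H m f.chart where
  mem_source := f.mem_source
  map_base := f.map_base
  smooth := f.smooth
  smooth_symm := f.smooth_symm
  mem_fiber_iff v := by
    rw [f.mem_fiber_iff m f.mem_source (by rw [f.map_base]; exact f.zero_mem_ball) v, f.map_base,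
      f.frame_zero]
    rfl

/-- Operator inversion is smooth at invertible operators. -/
theorem smooth_frame_symm : ContDiffOn ℝ ∞
    (fun z => ((f.frame z).symm : Coord p q →L[ℝ] Coord p q)) (Metric.ball 0 f.radius) := by
  intro z hz
  have h1 := f.smooth_frame z hz
  have h2 := contDiffAt_map_inverse (n := ∞) (f.frame z)
  have h3 := h2.comp_contDiffWithinAt z h1
  refine h3.congr (fun y _ => ?_) ?_ <;> exact (ContinuousLinearMap.inverse_equiv _).symm

/-- The base points where the frame is defined. -/
def dom : Set M := f.chart.source ∩ f.chart ⁻¹' Metric.ball 0 f.radius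

theorem isOpen_dom : IsOpen f.dom :=
  f.chart.isOpen_inter_preimage Metric.isOpen_ball

theorem base_mem_dom : m ∈ f.dom :=
  ⟨f.mem_source, by rw [mem_preimage, f.map_base]; exact f.zero_mem_ball⟩

/-- A local diffeomorphism into the ball gives a system of `H`-coordinates
`E_x(v) = L⁻¹(L(x) + σ(A(x) v))`, where `L` is the chart and `A` the frame. -/
def coordSystem (σ : OpenPartialHomeomorph (Coord p q) (Coord p q)) (hsource : σ.source = univ)
    (htarget : σ.target ⊆ Metric.ball 0 f.radius) (h0 : σ 0 = 0) (hs : ContDiff ℝ ∞ σ)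
    (hs' : ContDiffOn ℝ ∞ σ.symm σ.target)
    (hD : HasFDerivAt σ.symm (ContinuousLinearMap.id ℝ (Coord p q)) 0) : HCoordSystem H where
  dom := f.dom
  isOpen_dom := f.isOpen_dom
  toFun x v := f.chart.symm (σ (f.frame (f.chart x) v) + f.chart x)
  smooth := by
    have h1 : ContMDiffOn ((𝓡 (p + q)).prod 𝓘(ℝ, Coord p q)) 𝓘(ℝ, Coord p q) ∞
        (fun z : M × Coord p q => f.chart z.1) (f.dom ×ˢ univ) :=
      f.smooth.comp contMDiffOn_fst (fun z hz => hz.1.1)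
    have h2 : ContMDiffOn ((𝓡 (p + q)).prod 𝓘(ℝ, Coord p q)) 𝓘(ℝ, Coord p q →L[ℝ] Coord p q) ∞
        (fun z : M × Coord p q => (f.frame (f.chart z.1) : Coord p q →L[ℝ] Coord p q))
        (f.dom ×ˢ univ) :=
      f.smooth_frame.contMDiffOn.comp h1 (fun z hz => hz.1.2)
    have h3 : ContMDiffOn ((𝓡 (p + q)).prod 𝓘(ℝ, Coord p q)) 𝓘(ℝ, Coord p q) ∞
        (fun z : M × Coord p q => f.frame (f.chart z.1) z.2) (f.dom ×ˢ univ) :=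
      h2.clm_apply contMDiffOn_snd
    refine f.smooth_symm.comp ((hs.contMDiff.comp_contMDiffOn h3).add h1) ?_
    intro z hz
    refine f.ball_subset ?_
    have ha : ‖σ (f.frame (f.chart z.1) z.2)‖ < f.radius :=
      mem_ball_zero_iff.1 (htarget (σ.map_source (by rw [hsource]; trivial)))
    have hb : ‖f.chart z.1‖ < f.radius := mem_ball_zero_iff.1 hz.1.2
    rw [mem_ball_zero_iff]
    refine (norm_add_le _ _).trans_lt ?_
    linarith
  exists_chart := by
    intro x hx
    let A := f.frame (f.chart x)
    have h0t : (0 : Coord p q) ∈ σ.target := by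
      rw [← h0]; exact σ.map_source (by rw [hsource]; trivial)
    have h0' : σ.symm 0 = 0 := by
      conv_lhs => rw [← h0]
      exact σ.left_inv (by rw [hsource]; trivial)
    let φ : OpenPartialHomeomorph M (Coord p q) :=
      ((f.chart.transHomeomorph (Homeomorph.subRight (f.chart x))).trans σ.symm).transHomeomorph
        A.symm.toHomeomorph
    have happ : ∀ y, φ y = A.symm (σ.symm (f.chart y - f.chart x)) := fun y => rfl
    have hsymm : ∀ v, φ.symm v = f.chart.symm (σ (A v) + f.chart x) := fun v => rfl
    have hsrc : ∀ y ∈ φ.source, y ∈ f.chart.source ∧ f.chart y - f.chart x ∈ σ.target :=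
      fun y hy => hy
    have htar : ∀ v, σ (A v) + f.chart x ∈ f.chart.target := by
      intro v
      refine f.ball_subset ?_
      have ha : ‖σ (A v)‖ < f.radius :=
        mem_ball_zero_iff.1 (htarget (σ.map_source (by rw [hsource]; trivial)))
      have hb : ‖f.chart x‖ < f.radius := mem_ball_zero_iff.1 hx.2
      rw [mem_ball_zero_iff]
      refine (norm_add_le _ _).trans_lt ?_
      linarith
    refine ⟨φ, ⟨?_, ?_, ?_, ?_, ?_⟩, ?_, fun v => rfl⟩
    · refine ⟨hx.1, ?_⟩
      change f.chart x - f.chart x ∈ σ.target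
      rwa [sub_self]
    · rw [happ, sub_self, h0', map_zero]
    · have h1 : ContMDiffOn (𝓡 (p + q)) 𝓘(ℝ, Coord p q) ∞ (fun y => f.chart y - f.chart x)
          φ.source := (f.smooth.mono fun y hy => (hsrc y hy).1).sub contMDiffOn_const
      exact A.symm.contDiff.contMDiff.comp_contMDiffOn
        (hs'.contMDiffOn.comp h1 fun y hy => (hsrc y hy).2)
    · have h1 : ContDiff ℝ ∞ (fun v => σ (A v) + f.chart x) :=
        (hs.comp A.contDiff).add contDiff_const
      exact f.smooth_symm.comp h1.contMDiff.contMDiffOn fun v _ => htar v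
    · intro v
      have h1 : MDifferentiableAt (𝓡 (p + q)) 𝓘(ℝ, Coord p q) f.chart x :=
        (f.smooth.contMDiffAt (f.chart.open_source.mem_nhds hx.1)).mdifferentiableAt (by simp)
      -- As `σ⁻¹` has derivative `id` at `0`, the new chart has derivative `A(x)⁻¹ dL` at `x`, and
      -- the frame tests membership in `H_x` by exactly this map.
      have h2 : HasFDerivAt (fun z => A.symm (σ.symm (z - f.chart x)))
          (A.symm : Coord p q →L[ℝ] Coord p q) (f.chart x) := by
        have h3 : HasFDerivAt σ.symm (ContinuousLinearMap.id ℝ (Coord p q))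
            (f.chart x - f.chart x) := by rwa [sub_self]
        have h4 : HasFDerivAt (fun z : Coord p q => z - f.chart x)
            (ContinuousLinearMap.id ℝ (Coord p q)) (f.chart x) := (hasFDerivAt_id _).sub_const _
        exact A.symm.hasFDerivAt.comp (f.chart x)
          (HasFDerivAt.comp (f := fun z => z - f.chart x) (f.chart x) h3 h4)
      have h5 := mfderiv_comp_apply (I'' := 𝓘(ℝ, Coord p q)) x
        h2.differentiableAt.mdifferentiableAt h1 v
      rw [mfderiv_eq_fderiv, h2.fderiv] at h5
      rw [f.mem_fiber_iff x hx.1 hx.2 v]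
      have h6 : mfderiv (𝓡 (p + q)) 𝓘(ℝ, Coord p q) φ x v =
          A.symm (mfderiv (𝓡 (p + q)) 𝓘(ℝ, Coord p q) f.chart x v) := h5
      rw [h6]
    · ext v
      refine iff_of_true ?_ trivial
      refine ⟨?_, ?_⟩
      · change A v ∈ σ.source
        rw [hsource]; trivial
      · exact htar v

end AdaptedFrame

end coordinates

/-! ### Parabolic flows and composition of arrows -/

section flows

variable {p q : ℕ} {M : Type*} [TopologicalSpace M]
  [ChartedSpace (EuclideanSpace ℝ (Fin (p + q))) M] [IsManifold (𝓡 (p + q)) ∞ M]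
  {H : TangentDistribution p q M} {m : M}

theorem ParabolicFlow.isHCurve (Φ : ParabolicFlow H) (hm : (m, (0 : ℝ)) ∈ Φ.dom) :
    IsHCurve H m (Φ.toFun m) := by
  refine ⟨Φ.map_zero m hm, ?_, Φ.tangent m hm⟩
  have hc : Continuous fun t : ℝ => (m, t) := by fun_prop
  obtain ⟨ε, hε, hsub⟩ := exists_Ioo_subset
    (hc.continuousAt.preimage_mem_nhds (Φ.isOpen_dom.mem_nhds hm))
  exact ⟨ε, hε, Φ.smooth.comp (contMDiffOn_const.prodMk contMDiffOn_id) hsub⟩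

variable (f : AdaptedFrame H m)

namespace AdaptedFrame

/-- The bilinear form `b(h, h') = (∂_h A)(0) h'` modulo `H`, where `A` is the frame. -/
def form (h h' : EuclideanSpace ℝ (Fin p)) : EuclideanSpace ℝ (Fin q) :=
  (fderiv ℝ (fun z => (f.frame z : Coord p q →L[ℝ] Coord p q)) 0 (h, 0) (h', 0)).2

/-- The group law `(h', n') * (h, n) = (h' + h, n' + n + b(h, h'))` of the osculating group. -/
def product (u v : Coord p q) : Coord p q := (u.1 + v.1, u.2 + v.2 + f.form v.1 u.1)

theorem hasFDerivAt_frame : HasFDerivAt (fun z => (f.frame z : Coord p q →L[ℝ] Coord p q))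
    (fderiv ℝ (fun z => (f.frame z : Coord p q →L[ℝ] Coord p q)) 0) 0 :=
  ((f.smooth_frame.contDiffAt (Metric.isOpen_ball.mem_nhds f.zero_mem_ball)).differentiableAt
    (by simp)).hasFDerivAt

/-- The generator lies in `H` at every point near `m`, not only at `m`. This is what determines the
normal part of its derivative along a curve. -/
theorem frame_symm_deriv_snd (Φ : ParabolicFlow H) {x : M} (hx : x ∈ f.dom)
    (hΦ : (x, (0 : ℝ)) ∈ Φ.dom) :
    ((f.frame (f.chart x)).symm (deriv (fun t => f.chart (Φ.toFun x t)) 0)).2 = 0 := by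
  have hc := Φ.isHCurve hΦ
  have hb := hc.base
  have hs := hc.contMDiffAt.mdifferentiableAt (by simp)
  have ht := hc.tangent
  have hx' : Φ.toFun x 0 ∈ f.dom := by rwa [hb]
  have hφ : MDifferentiableAt (𝓡 (p + q)) 𝓘(ℝ, Coord p q) f.chart (Φ.toFun x 0) :=
    (f.smooth.contMDiffAt (f.chart.open_source.mem_nhds hx'.1)).mdifferentiableAt (by simp)
  rw [deriv_comp_curve hφ hs]
  have := (f.mem_fiber_iff _ hx'.1 hx'.2 _).1 ht
  have e : f.frame (f.chart x) = f.frame (f.chart (Φ.toFun x 0)) := by rw [hb]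
  rw [e]
  exact this

/-- The composed curve is the diagonal of `G (s, t) = L(Φ_t(ψ(s)))`. The mixed term is twice the
derivative of the generator along `ψ`; the factor `1/2` in the jet leaves a single `form` term. -/
theorem comp_flow (Φ Ψ : ParabolicFlow H) (hΦ : (m, (0 : ℝ)) ∈ Φ.dom)
    (hΨ : (m, (0 : ℝ)) ∈ Ψ.dom) :
    ∃ hc : IsHCurve H m (fun t => Φ.toFun (Ψ.toFun m t) t),
      f.isHChart.coords (arrow hc) = f.product (f.isHChart.coords (arrow (Φ.isHCurve hΦ)))
        (f.isHChart.coords (arrow (Ψ.isHCurve hΨ))) := by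
  set ψ := Ψ.toFun m
  have hψ : IsHCurve H m ψ := Ψ.isHCurve hΨ
  have hφ : IsHCurve H m (Φ.toFun m) := Φ.isHCurve hΦ
  have hψ0 : ψ 0 = m := hψ.base
  have hψc : ContinuousAt ψ 0 := hψ.contMDiffAt.continuousAt
  set L := f.chart
  set G : ℝ × ℝ → Coord p q := fun z => L (Φ.toFun (ψ z.1) z.2) with hGdef
  -- smoothness of the composed curve near `0`
  obtain ⟨ε, hε, hψs⟩ := hψ.smooth
  have hΨopen : IsOpen (Ioo (-ε) ε ∩ (fun t => (ψ t, t)) ⁻¹' Φ.dom) :=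
    (hψs.continuousOn.prodMk continuousOn_id).isOpen_inter_preimage isOpen_Ioo Φ.isOpen_dom
  have h0mem : (0 : ℝ) ∈ Ioo (-ε) ε ∩ (fun t => (ψ t, t)) ⁻¹' Φ.dom :=
    ⟨⟨by linarith, hε⟩, by rwa [mem_preimage, hψ0]⟩
  obtain ⟨δ, hδ, hδsub⟩ := exists_Ioo_subset (hΨopen.mem_nhds h0mem)
  have hcs : ContMDiffOn 𝓘(ℝ, ℝ) (𝓡 (p + q)) ∞ (fun t => Φ.toFun (ψ t) t) (Ioo (-δ) δ) :=
    Φ.smooth.comp ((hψs.mono fun t ht => (hδsub ht).1).prodMk contMDiffOn_id)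
      fun t ht => (hδsub ht).2
  have hc0 : Φ.toFun (ψ 0) 0 = m := by rw [hψ0]; exact hφ.base
  -- smoothness of `G`
  have hG : ContDiffAt ℝ ∞ G 0 := by
    rw [← contMDiffAt_iff_contDiffAt]
    have h1 : ContMDiffAt 𝓘(ℝ, ℝ × ℝ) (𝓡 (p + q)) ∞ (fun z : ℝ × ℝ => ψ z.1) 0 :=
      ContMDiffAt.comp (g := ψ) (0 : ℝ × ℝ) hψ.contMDiffAt contDiffAt_fst.contMDiffAt
    have h2 : ContMDiffAt 𝓘(ℝ, ℝ × ℝ) 𝓘(ℝ, ℝ) ∞ (fun z : ℝ × ℝ => z.2) 0 :=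
      contDiffAt_snd.contMDiffAt
    have h3 : ContMDiffAt ((𝓡 (p + q)).prod 𝓘(ℝ, ℝ)) (𝓡 (p + q)) ∞
        (fun z : M × ℝ => Φ.toFun z.1 z.2) (ψ (0 : ℝ × ℝ).1, (0 : ℝ × ℝ).2) := by
      refine Φ.smooth.contMDiffAt (Φ.isOpen_dom.mem_nhds ?_)
      change (ψ 0, (0 : ℝ)) ∈ Φ.dom
      rwa [hψ0]
    have h4 : ContMDiffAt 𝓘(ℝ, ℝ × ℝ) (𝓡 (p + q)) ∞
        (fun z : ℝ × ℝ => Φ.toFun (ψ z.1) z.2) 0 :=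
      ContMDiffAt.comp (g := fun z : M × ℝ => Φ.toFun z.1 z.2)
        (f := fun z : ℝ × ℝ => (ψ z.1, z.2)) (0 : ℝ × ℝ) h3 (h1.prodMk h2)
    refine ContMDiffAt.comp (g := L) (0 : ℝ × ℝ) ?_ h4
    change ContMDiffAt _ _ _ _ (Φ.toFun (ψ 0) 0)
    rw [hc0]
    exact f.isHChart.contMDiffAt
  have hG2 : ContDiffAt ℝ 2 G 0 := hG.of_le two_le_infty
  -- the generating vector field along `ψ`
  set X : ℝ → Coord p q := fun s => deriv (fun t => G (s, t)) 0 with hX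
  have hXd : DifferentiableAt ℝ X 0 := (hasDerivAt_deriv_snd hG2).differentiableAt
  have hev : ∀ᶠ s in 𝓝 0, ψ s ∈ f.dom ∧ (ψ s, (0 : ℝ)) ∈ Φ.dom := by
    refine (hψc.eventually (p := fun x => x ∈ f.dom) ?_).and
      ((hψc.prodMk continuousAt_const).eventually (p := fun x => x ∈ Φ.dom) ?_)
    · rw [hψ0]; exact f.isOpen_dom.mem_nhds f.base_mem_dom
    · change ∀ᶠ y in 𝓝 (ψ 0, (0 : ℝ)), y ∈ Φ.dom
      rw [hψ0]
      exact Φ.isOpen_dom.mem_nhds hΦ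
  have hy := f.isHChart.contDiffAt_comp hψ
  have hyd : HasDerivAt (fun s => L (ψ s)) (deriv (fun s => L (ψ s)) 0) 0 :=
    (hy.differentiableAt (by simp)).hasDerivAt
  have hy0 : L (ψ 0) = 0 := f.isHChart.apply_curve_zero hψ
  set A' := fderiv ℝ (fun z => (f.frame z : Coord p q →L[ℝ] Coord p q)) 0 with hA'
  have hA : HasDerivAt (fun s => (f.frame (L (ψ s)) : Coord p q →L[ℝ] Coord p q))
      (A' (deriv (fun s => L (ψ s)) 0)) 0 := by
    have h1 := f.hasFDerivAt_frame
    rw [← hy0] at h1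
    have h2 := h1.comp_hasDerivAt (0 : ℝ) hyd
    rwa [hy0] at h2
  have hAi : DifferentiableAt ℝ
      (fun s => ((f.frame (L (ψ s))).symm : Coord p q →L[ℝ] Coord p q)) 0 := by
    have h1 : DifferentiableAt ℝ
        (fun z => ((f.frame z).symm : Coord p q →L[ℝ] Coord p q)) (L (ψ 0)) := by
      rw [hy0]
      exact (f.smooth_frame_symm.contDiffAt
        (Metric.isOpen_ball.mem_nhds f.zero_mem_ball)).differentiableAt (by simp)
    exact h1.comp (0 : ℝ) hyd.differentiableAt
  set k : ℝ → Coord p q := fun s => (f.frame (L (ψ s))).symm (X s) with hk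
  have hkd : HasDerivAt k (deriv k 0) 0 := (hAi.clm_apply hXd).hasDerivAt
  -- The frame coordinates `k` of the generator have zero normal part for all small `s`, hence so
  -- does their derivative.
  have hk2 : (deriv k 0).2 = 0 := by
    have e : (fun s => (k s).2) =ᶠ[𝓝 0] fun _ => 0 := by
      filter_upwards [hev] with s hs
      exact f.frame_symm_deriv_snd Φ hs.1 hs.2
    rw [← deriv_snd hkd.differentiableAt, e.deriv_eq, deriv_const]
  have hX0 : X 0 = deriv (fun t => L (Φ.toFun m t)) 0 := by
    simp only [hX, hGdef, hψ0]
  have hk0 : k 0 = X 0 := by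
    simp only [hk, hy0, f.frame_zero]
    rfl
  have hXk : X = fun s => (f.frame (L (ψ s)) : Coord p q →L[ℝ] Coord p q) (k s) := by
    funext s
    exact ((f.frame (L (ψ s))).apply_symm_apply (X s)).symm
  -- Differentiating `X = A k` at `0`, where `A = id`: modulo `H` only the term from the derivative
  -- of the frame survives.
  have hX' : deriv X 0 = A' (deriv (fun s => L (ψ s)) 0) (X 0) + deriv k 0 := by
    have h1 := (hA.clm_apply hkd).deriv
    rw [← hXk, hk0, hy0, f.frame_zero] at h1
    exact h1
  -- derivatives of the composition
  have e1 : (fun s => G (s, 0)) =ᶠ[𝓝 0] fun s => L (ψ s) := by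
    filter_upwards [hev] with s hs
    simp only [hGdef]
    rw [Φ.map_zero _ hs.2]
  have e2 : (fun t => G (0, t)) = fun t => L (Φ.toFun m t) := by
    funext t
    simp only [hGdef, hψ0]
  have d1 : deriv (fun t => L (Φ.toFun (ψ t) t)) 0 =
      deriv (fun s => L (ψ s)) 0 + deriv (fun t => L (Φ.toFun m t)) 0 := by
    have := deriv_diagonal (hG.differentiableAt (by simp))
    rwa [e1.deriv_eq, e2] at this
  have d2 : deriv (deriv fun t => L (Φ.toFun (ψ t) t)) 0 =
      deriv (deriv fun s => L (ψ s)) 0 + (2 : ℝ) • deriv X 0 +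
        deriv (deriv fun t => L (Φ.toFun m t)) 0 := by
    have := deriv_deriv_diagonal hG2
    rwa [e1.deriv.deriv_eq, e2] at this
  have hs1 := f.isHChart.deriv_snd hψ
  have hs2 := f.isHChart.deriv_snd hφ
  have hc : IsHCurve H m (fun t => Φ.toFun (ψ t) t) := by
    refine ⟨hc0, ⟨δ, hδ, hcs⟩, ?_⟩
    refine (f.isHChart.tangent_iff (c := fun t => Φ.toFun (ψ t) t) hc0
      ((hcs.contMDiffAt (Ioo_mem_nhds (by linarith) hδ)).mdifferentiableAt (by simp))).2 ?_
    change (deriv (fun t => L (Φ.toFun (ψ t) t)) 0).2 = 0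
    rw [d1, Prod.snd_add, hs1, hs2, add_zero]
  refine ⟨hc, ?_⟩
  rw [IsHChart.coords_arrow, IsHChart.coords_arrow, IsHChart.coords_arrow]
  change jet (fun t => L (Φ.toFun (ψ t) t)) =
    f.product (jet fun t => L (Φ.toFun m t)) (jet fun t => L (ψ t))
  simp only [jet, product, d1, d2, form, hX', hX0]
  have p1 : deriv (fun s => L (ψ s)) 0 = ((deriv (fun s => L (ψ s)) 0).1, 0) :=
    Prod.ext rfl hs1
  have p2 : deriv (fun t => L (Φ.toFun m t)) 0 = ((deriv (fun t => L (Φ.toFun m t)) 0).1, 0) :=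
    Prod.ext rfl hs2
  rw [← p1, ← p2, ← hA']
  refine Prod.ext ?_ ?_
  · simp only [Prod.fst_add]
    abel
  · simp only [Prod.snd_add, Prod.smul_snd, hk2]
    module

/-- The map `(x, t) ↦ L(x) + t A(x)(h, 0) + t² (0, n)`. -/
def flowMap (v : Coord p q) (z : M × ℝ) : Coord p q :=
  f.chart z.1 + (z.2 • f.frame (f.chart z.1) (v.1, 0) + z.2 ^ 2 • ((0, v.2) : Coord p q))

theorem smooth_flowMap (v : Coord p q) :
    ContMDiffOn ((𝓡 (p + q)).prod 𝓘(ℝ, ℝ)) 𝓘(ℝ, Coord p q) ∞ (f.flowMap v) (f.dom ×ˢ univ) := by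
  have h1 : ContMDiffOn ((𝓡 (p + q)).prod 𝓘(ℝ, ℝ)) 𝓘(ℝ, Coord p q) ∞
      (fun z : M × ℝ => f.chart z.1) (f.dom ×ˢ univ) :=
    f.smooth.comp contMDiffOn_fst (fun z hz => hz.1.1)
  have h2 : ContMDiffOn ((𝓡 (p + q)).prod 𝓘(ℝ, ℝ)) 𝓘(ℝ, Coord p q →L[ℝ] Coord p q) ∞
      (fun z : M × ℝ => (f.frame (f.chart z.1) : Coord p q →L[ℝ] Coord p q)) (f.dom ×ˢ univ) :=
    f.smooth_frame.contMDiffOn.comp h1 (fun z hz => hz.1.2)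
  have h3 : ContMDiffOn ((𝓡 (p + q)).prod 𝓘(ℝ, ℝ)) 𝓘(ℝ, Coord p q) ∞
      (fun z : M × ℝ => f.frame (f.chart z.1) ((v.1, 0) : Coord p q)) (f.dom ×ˢ univ) :=
    h2.clm_apply contMDiffOn_const
  have h4 : ContMDiffOn ((𝓡 (p + q)).prod 𝓘(ℝ, ℝ)) 𝓘(ℝ, Coord p q) ∞
      (fun z : M × ℝ => z.2 ^ 2 • ((0, v.2) : Coord p q)) (f.dom ×ˢ univ) :=
    (by fun_prop : ContDiff ℝ ∞ fun t : ℝ =>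
      t ^ 2 • ((0, v.2) : Coord p q)).contMDiff.comp_contMDiffOn contMDiffOn_snd
  exact h1.add ((contMDiffOn_snd.smul h3).add h4)

/-- The domain of the flow `x ↦ L⁻¹(L(x) + t A(x)(h, 0) + t² (0, n))`. -/
def flowDom (v : Coord p q) : Set (M × ℝ) :=
  (f.dom ×ˢ univ) ∩ f.flowMap v ⁻¹' f.chart.target

theorem isOpen_flowDom (v : Coord p q) : IsOpen (f.flowDom v) :=
  (f.smooth_flowMap v).continuousOn.isOpen_inter_preimage (f.isOpen_dom.prod isOpen_univ)
    f.chart.open_target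

theorem smooth_flow (v : Coord p q) : ContMDiffOn ((𝓡 (p + q)).prod 𝓘(ℝ, ℝ)) (𝓡 (p + q)) ∞
    (fun z => f.chart.symm (f.flowMap v z)) (f.flowDom v) :=
  f.smooth_symm.comp ((f.smooth_flowMap v).mono inter_subset_left) fun _ hz => hz.2

theorem flowMap_zero (v : Coord p q) (x : M) : f.flowMap v (x, 0) = f.chart x := by
  simp [flowMap]

theorem hasDerivAt_flowMap (v : Coord p q) (x : M) :
    HasDerivAt (fun t => f.flowMap v (x, t)) (f.frame (f.chart x) (v.1, 0)) 0 := by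
  have h1 := (hasDerivAt_id (0 : ℝ)).smul_const (f.frame (f.chart x) (v.1, 0))
  have h2 := (hasDerivAt_pow 2 (0 : ℝ)).smul_const ((0, v.2) : Coord p q)
  refine ((h1.add h2).const_add (f.chart x)).congr_deriv ?_
  simp

/-- The parabolic flow `x ↦ L⁻¹(L(x) + t A(x)(h, 0) + t² (0, n))`. -/
def flow (v : Coord p q) : ParabolicFlow H where
  dom := f.flowDom v
  isOpen_dom := f.isOpen_flowDom v
  toFun x t := f.chart.symm (f.flowMap v (x, t))
  smooth := f.smooth_flow v
  map_zero x hx := by rw [flowMap_zero, f.chart.left_inv hx.1.1.1]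
  tangent x hx := by
    have h0 : f.chart.symm (f.flowMap v (x, 0)) = x := by
      rw [flowMap_zero, f.chart.left_inv hx.1.1.1]
    have hx' : f.chart.symm (f.flowMap v (x, 0)) ∈ f.dom := by rw [h0]; exact hx.1.1
    have hφ : MDifferentiableAt (𝓡 (p + q)) 𝓘(ℝ, Coord p q) f.chart
        (f.chart.symm (f.flowMap v (x, 0))) :=
      (f.smooth.contMDiffAt (f.chart.open_source.mem_nhds hx'.1)).mdifferentiableAt (by simp)
    have hcurve : MDifferentiableAt 𝓘(ℝ, ℝ) (𝓡 (p + q))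
        (fun t => f.chart.symm (f.flowMap v (x, t))) 0 := by
      have h1 := (f.smooth_flow v).contMDiffAt ((f.isOpen_flowDom v).mem_nhds hx)
      have h2 : ContMDiffAt 𝓘(ℝ, ℝ) ((𝓡 (p + q)).prod 𝓘(ℝ, ℝ)) ∞ (fun t : ℝ => (x, t)) 0 :=
        contMDiffAt_const.prodMk contMDiffAt_id
      exact (ContMDiffAt.comp (f := fun t : ℝ => (x, t)) (0 : ℝ) h1 h2).mdifferentiableAt (by simp)
    refine (f.mem_fiber_iff _ hx'.1 hx'.2 _).2 ?_
    have hd := deriv_comp_curve (c := fun t => f.chart.symm (f.flowMap v (x, t))) (t := 0) hφ hcurve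
    have he : (fun t => f.chart (f.chart.symm (f.flowMap v (x, t)))) =ᶠ[𝓝 0]
        fun t => f.flowMap v (x, t) := by
      filter_upwards [(f.hasDerivAt_flowMap v x).continuousAt
        (f.chart.open_target.mem_nhds hx.2)] with t ht
      exact f.chart.right_inv ht
    rw [he.deriv_eq, (f.hasDerivAt_flowMap v x).deriv] at hd
    have e : (f.frame (f.chart (f.chart.symm (f.flowMap v (x, 0))))).symm
        (f.frame (f.chart x) (v.1, 0)) = (v.1, 0) := by
      rw [h0, ContinuousLinearEquiv.symm_apply_apply]
    rw [hd] at e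
    exact congrArg Prod.snd e

theorem base_mem_flow_dom (v : Coord p q) : (m, (0 : ℝ)) ∈ (f.flow v).dom := by
  refine ⟨⟨f.base_mem_dom, trivial⟩, ?_⟩
  rw [mem_preimage, flowMap_zero]
  exact f.chart.map_source f.mem_source

/-- At `m` the frame is the identity and `L(m) = 0`, so the flow line is `L⁻¹(t h, t² n)`. Thus
every arrow comes from a parabolic flow. -/
theorem coords_flow (v : Coord p q) :
    f.isHChart.coords (arrow ((f.flow v).isHCurve (f.base_mem_flow_dom v))) = v := by
  rw [IsHChart.coords_arrow]
  have h : ∀ t : ℝ, (f.flow v).toFun m t = f.chart.symm (t • v.1, t ^ 2 • v.2) := by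
    intro t
    change f.chart.symm (f.flowMap v (m, t)) = _
    simp [flowMap, f.map_base, f.frame_zero]
  simp only [h]
  have hg : Continuous (fun t : ℝ => ((t • v.1, t ^ 2 • v.2) : Coord p q)) := by fun_prop
  exact (jet_congr (f.isHChart.symm_comp_eventually hg.continuousAt (by simp))).trans
    (jet_dilation v).2

/-! ### The osculating group -/

theorem form_add_left (h₁ h₂ h' : EuclideanSpace ℝ (Fin p)) :
    f.form (h₁ + h₂) h' = f.form h₁ h' + f.form h₂ h' := by
  have : ((h₁ + h₂, 0) : Coord p q) = (h₁, 0) + (h₂, 0) := by simp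
  simp only [form, this, map_add]
  rfl

theorem form_add_right (h h₁ h₂ : EuclideanSpace ℝ (Fin p)) :
    f.form h (h₁ + h₂) = f.form h h₁ + f.form h h₂ := by
  have : ((h₁ + h₂, 0) : Coord p q) = (h₁, 0) + (h₂, 0) := by simp
  simp only [form, this, map_add]
  rfl

theorem form_zero_left (h : EuclideanSpace ℝ (Fin p)) : f.form 0 h = 0 := by
  simpa using f.form_add_left 0 0 h

theorem form_zero_right (h : EuclideanSpace ℝ (Fin p)) : f.form h 0 = 0 := by
  simpa using f.form_add_right h 0 0

theorem form_neg_left (h h' : EuclideanSpace ℝ (Fin p)) : f.form (-h) h' = -f.form h h' := by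
  rw [eq_neg_iff_add_eq_zero, ← form_add_left, neg_add_cancel, form_zero_left]

theorem form_neg_right (h h' : EuclideanSpace ℝ (Fin p)) : f.form h (-h') = -f.form h h' := by
  rw [eq_neg_iff_add_eq_zero, ← form_add_right, neg_add_cancel, form_zero_right]

/-- The group structure on the coordinate space defined by `product`. -/
abbrev coordGroup : Group (Coord p q) where
  mul := f.product
  one := 0
  -- The correction `b(h, h)` cancels the term `b(h, -h)` of the product; `b` is not assumed
  -- alternating.
  inv v := (-v.1, -v.2 + f.form v.1 v.1)
  mul_assoc u v w := by
    change f.product (f.product u v) w = f.product u (f.product v w)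
    simp only [product, form_add_left, form_add_right]
    refine Prod.ext ?_ ?_ <;> dsimp only <;> abel
  one_mul v := by
    change f.product 0 v = v
    simp [product, form_zero_right]
  mul_one v := by
    change f.product v 0 = v
    simp [product, form_zero_left]
  inv_mul_cancel v := by
    change f.product (-v.1, -v.2 + f.form v.1 v.1) v = 0
    simp [product, form_neg_right]

/-- The osculating group structure on the parabolic arrows at `m`. -/
abbrev osculatingGroup : Group (Arrow H m) :=
  letI := f.coordGroup
  f.isHChart.coordsEquiv.group

theorem coords_mul (u v : Arrow H m) : letI := f.osculatingGroup
    f.isHChart.coords (u * v) = f.product (f.isHChart.coords u) (f.isHChart.coords v) :=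
  f.isHChart.coordsEquiv.apply_symm_apply _

theorem coords_inv (u : Arrow H m) : let _ := f.osculatingGroup
    f.isHChart.coords u⁻¹ = (-(f.isHChart.coords u).1, -(f.isHChart.coords u).2 +
      f.form (f.isHChart.coords u).1 (f.isHChart.coords u).1) :=
  f.isHChart.coordsEquiv.apply_symm_apply _

/-- One direction is independence of the representing flows, from the coordinate formula; the other
realises any two arrows by the explicit flows. -/
theorem isComposition_iff (u v w : Arrow H m) : let _ := f.osculatingGroup
    IsComposition u v w ↔ u * v = w := by
  let _ := f.osculatingGroup
  constructor
  · rintro ⟨Φ, Ψ, hΦ, hΨ, ⟨hu, rfl⟩, ⟨hv, rfl⟩, ⟨hw, rfl⟩⟩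
    obtain ⟨hc, h⟩ := f.comp_flow Φ Ψ hΦ hΨ
    apply f.isHChart.coords_injective
    rw [f.coords_mul]
    exact h.symm
  · rintro rfl
    set x := f.isHChart.coords u with hx
    set y := f.isHChart.coords v with hy
    obtain ⟨hc, h⟩ := f.comp_flow (f.flow x) (f.flow y) (f.base_mem_flow_dom x)
      (f.base_mem_flow_dom y)
    refine ⟨f.flow x, f.flow y, f.base_mem_flow_dom x, f.base_mem_flow_dom y,
      ⟨_, f.isHChart.coords_injective (f.coords_flow x)⟩,
      ⟨_, f.isHChart.coords_injective (f.coords_flow y)⟩, ⟨hc, f.isHChart.coords_injective ?_⟩⟩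
    rw [h, f.coords_mul, f.coords_flow, f.coords_flow]

end AdaptedFrame

end flows

/-! ### Limits in the parabolic tangent groupoid -/

section limits

variable {p q : ℕ} {M : Type*} [TopologicalSpace M]
  [ChartedSpace (EuclideanSpace ℝ (Fin (p + q))) M] [IsManifold (𝓡 (p + q)) ∞ M]
  {H : TangentDistribution p q M} {m : M} (f : AdaptedFrame H m)

/-- Multiplication by a scalar function tending to `1` does not change parabolic limits. -/
theorem tendsto_smul_dilation {s : Coord p q → ℝ} (hs : ContinuousAt s 0)
    (h0 : s 0 = 1) {w k : ℝ → Coord p q} {l : Filter ℝ} {v : Coord p q}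
    (hw : Tendsto w l (𝓝 0))
    (hk : Tendsto (fun t : ℝ => (t⁻¹ • (k t).1, (t⁻¹) ^ 2 • (k t).2)) l (𝓝 v)) :
    Tendsto (fun t : ℝ => (t⁻¹ • (s (w t) • k t).1, (t⁻¹) ^ 2 • (s (w t) • k t).2)) l (𝓝 v) := by
  have h1 : Tendsto (fun t => s (w t)) l (𝓝 1) := by
    rw [← h0]
    exact Tendsto.comp hs hw
  have h2 := h1.smul hk
  rw [one_smul] at h2
  refine h2.congr fun t => ?_
  refine Prod.ext ?_ ?_
  · exact smul_comm _ _ _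
  · exact smul_comm _ _ _

namespace AdaptedFrame

/-- The radial form `σ⁻¹(w) = s(w) w` makes `E_x` explicitly invertible: with `w = L(y) - L(x)`, the
point `y` has coordinates `A(x)⁻¹(s(w) w)`, a scalar multiple of `A(x)⁻¹ w`. At `m` the frame drops
out. -/
theorem exists_coordSystem : ∃ (E : HCoordSystem H) (s : Coord p q → ℝ) (N : Set (Coord p q)),
    E.dom = f.dom ∧ N ∈ 𝓝 0 ∧ ContinuousAt s 0 ∧ s 0 = 1 ∧
    (∀ x ∈ f.dom, ∀ y ∈ f.chart.source, f.chart y - f.chart x ∈ N →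
      E.toFun x ((f.frame (f.chart x)).symm
        (s (f.chart y - f.chart x) • (f.chart y - f.chart x))) = y) ∧
    ∀ v, s (f.chart (E.toFun m v)) • f.chart (E.toFun m v) = v := by
  obtain ⟨σ, hsource, htarget, h0, hs, hs', s, hsc, hs0, hsymm⟩ :=
    exists_diffeomorph_into_ball (p := p) (q := q) f.radius_pos
  have hD : HasFDerivAt σ.symm (ContinuousLinearMap.id ℝ (Coord p q)) 0 := by
    have : (σ.symm : Coord p q → Coord p q) = fun w => s w • w := funext hsymm
    rw [this]
    exact hasFDerivAt_smul_self hsc hs0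
  have hmem : ∀ v, v ∈ σ.source := fun v => by rw [hsource]; trivial
  refine ⟨f.coordSystem σ hsource htarget h0 hs hs' hD, s, σ.target, rfl, ?_, hsc, hs0, ?_, ?_⟩
  · refine σ.open_target.mem_nhds ?_
    rw [← h0]
    exact σ.map_source (hmem 0)
  · intro x _ y hy hN
    change f.chart.symm (σ (f.frame (f.chart x) ((f.frame (f.chart x)).symm _)) + f.chart x) = y
    rw [ContinuousLinearEquiv.apply_symm_apply, ← hsymm, σ.right_inv hN, sub_add_cancel,
      f.chart.left_inv hy]
  · intro v
    have h1 : f.chart (f.chart.symm (σ (f.frame (f.chart m) v) + f.chart m)) = σ v := by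
      rw [f.map_base, f.frame_zero, add_zero]
      refine f.chart.right_inv (f.ball_subset ?_)
      refine Metric.ball_subset_ball ?_ (htarget (σ.map_source (hmem v)))
      linarith [f.radius_pos]
    change s (f.chart (f.chart.symm (σ (f.frame (f.chart m) v) + f.chart m))) •
      f.chart (f.chart.symm (σ (f.frame (f.chart m) v) + f.chart m)) = v
    rw [h1, ← hsymm, σ.left_inv (hmem v)]

/-- The parabolic limit of `A(b(t))⁻¹ (a(t) - b(t))` in an adapted chart. -/
theorem tendsto_frame_symm_sub {a b : ℝ → M} (ha : IsHCurve H m a) (hb : IsHCurve H m b) :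
    let _ := f.osculatingGroup
    let k := fun t => (f.frame (f.chart (b t))).symm (f.chart (a t) - f.chart (b t))
    Tendsto (fun t : ℝ => (t⁻¹ • (k t).1, (t⁻¹) ^ 2 • (k t).2)) (𝓝[≠] 0)
      (𝓝 (f.isHChart.coords (arrow ha * (arrow hb)⁻¹))) := by
  intro _ k
  have hx := f.isHChart.contDiffAt_comp ha
  have hy := f.isHChart.contDiffAt_comp hb
  set x : ℝ → Coord p q := fun t => f.chart (a t)
  set y : ℝ → Coord p q := fun t => f.chart (b t)
  have hx0 : x 0 = 0 := f.isHChart.apply_curve_zero ha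
  have hy0 : y 0 = 0 := f.isHChart.apply_curve_zero hb
  have hx1 : (deriv x 0).2 = 0 := f.isHChart.deriv_snd ha
  have hy1 : (deriv y 0).2 = 0 := f.isHChart.deriv_snd hb
  have hball : Metric.ball (0 : Coord p q) f.radius ∈ 𝓝 (y 0) := by
    rw [hy0]; exact Metric.isOpen_ball.mem_nhds f.zero_mem_ball
  have hA : ContDiffAt ℝ ∞ (fun t => (f.frame (y t) : Coord p q →L[ℝ] Coord p q)) 0 :=
    (f.smooth_frame.contDiffAt hball).comp (0 : ℝ) hy
  have hAi : ContDiffAt ℝ ∞ (fun t => ((f.frame (y t)).symm : Coord p q →L[ℝ] Coord p q)) 0 :=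
    (f.smooth_frame_symm.contDiffAt hball).comp (0 : ℝ) hy
  have hk : ContDiffAt ℝ ∞ k 0 := hAi.clm_apply (hx.sub hy)
  have hk0 : k 0 = 0 := by
    change (f.frame (y 0)).symm (x 0 - y 0) = 0
    rw [hx0, hy0, sub_zero, map_zero]
  have hyd : HasDerivAt y (deriv y 0) 0 := (hy.differentiableAt (by simp)).hasDerivAt
  have hA' : HasDerivAt (fun t => (f.frame (y t) : Coord p q →L[ℝ] Coord p q))
      (fderiv ℝ (fun z => (f.frame z : Coord p q →L[ℝ] Coord p q)) 0 (deriv y 0)) 0 := by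
    have h1 := f.hasFDerivAt_frame
    rw [← hy0] at h1
    have h2 := HasFDerivAt.comp_hasDerivAt (f := y) (0 : ℝ) h1 hyd
    rwa [hy0] at h2
  have hw : (fun t => (f.frame (y t) : Coord p q →L[ℝ] Coord p q) (k t)) = x - y := by
    funext t
    exact (f.frame (y t)).apply_symm_apply _
  have hframe0 : (f.frame (y 0) : Coord p q →L[ℝ] Coord p q) =
      ContinuousLinearMap.id ℝ (Coord p q) := by
    rw [hy0, f.frame_zero]
    rfl
  have hd1 : deriv k 0 = deriv x 0 - deriv y 0 := by
    have h1 := (hA'.clm_apply (hk.differentiableAt (by simp)).hasDerivAt).deriv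
    rw [hw, hk0, map_zero, zero_add, hframe0, deriv_sub (hx.differentiableAt (by simp))
      hyd.differentiableAt] at h1
    exact h1.symm
  -- From `A k = x - y` and `k 0 = 0`, the Leibniz rule leaves `x'' - y'' = 2 A' k' + k''` at `0`,
  -- with `k' = x' - y'`.
  have hd2 : deriv (deriv k) 0 = deriv (deriv x) 0 - deriv (deriv y) 0 -
      (2 : ℝ) • fderiv ℝ (fun z => (f.frame z : Coord p q →L[ℝ] Coord p q)) 0 (deriv y 0)
        (deriv x 0 - deriv y 0) := by
    have h1 := deriv_deriv_clm_apply (hA.of_le two_le_infty) (hk.of_le two_le_infty)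
    rw [hw, hk0, map_zero, zero_add, hframe0, hA'.deriv, hd1] at h1
    have h2 : deriv (x - y) =ᶠ[𝓝 0] deriv x - deriv y := by
      filter_upwards [(hx.of_le two_le_infty).eventually (by simp),
        (hy.of_le two_le_infty).eventually (by simp)] with t h3 h4
      exact deriv_sub (h3.differentiableAt (by simp)) (h4.differentiableAt (by simp))
    rw [h2.deriv_eq, deriv_sub
      ((contDiffAt_deriv (n := 1) (hx.of_le two_le_infty) (by norm_num)).differentiableAt (by simp))
      ((contDiffAt_deriv (n := 1) (hy.of_le two_le_infty) (by norm_num)).differentiableAt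
        (by simp))] at h1
    rw [h1]
    simp
  have hk1 : (deriv k 0).2 = 0 := by rw [hd1, Prod.snd_sub, hx1, hy1, sub_zero]
  have hlim := tendsto_jet (hk.of_le two_le_infty) hk0 hk1
  have hjet : jet k = f.isHChart.coords (arrow ha * (arrow hb)⁻¹) := by
    rw [f.coords_mul, f.coords_inv, IsHChart.coords_arrow, IsHChart.coords_arrow]
    change jet k = f.product (jet x) (-(jet y).1, -(jet y).2 + f.form (jet y).1 (jet y).1)
    have p1 : deriv y 0 = ((deriv y 0).1, 0) := Prod.ext rfl hy1
    have p2 : deriv x 0 - deriv y 0 = ((deriv x 0).1 - (deriv y 0).1, 0) :=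
      Prod.ext rfl (by rw [Prod.snd_sub, hx1, hy1, sub_zero])
    have p3 : (fderiv ℝ (fun z => (f.frame z : Coord p q →L[ℝ] Coord p q)) 0 (deriv y 0)
        (deriv x 0 - deriv y 0)).2 =
        f.form (deriv y 0).1 (deriv x 0).1 - f.form (deriv y 0).1 (deriv y 0).1 := by
      rw [p2, p1, sub_eq_add_neg, sub_eq_add_neg, ← form_neg_right, ← form_add_right]
      rfl
    simp only [product, jet, hd1, hd2, Prod.snd_sub, Prod.fst_sub, Prod.smul_snd, p3,
      form_neg_left]
    refine Prod.ext ?_ ?_ <;> dsimp only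
    · abel
    · module
  rwa [hjet] at hlim

/-- Arrow coordinates in the chart of the frame agree with the Taylor coordinates of the system of
`H`-coordinates. -/
theorem coords_taylor_base {E : HCoordSystem H} {s : Coord p q → ℝ} (hm : m ∈ E.dom)
    (hs : ContinuousAt s 0) (h0 : s 0 = 1)
    (hE : ∀ v, s (f.chart (E.toFun m v)) • f.chart (E.toFun m v) = v) (v : Coord p q) :
    f.isHChart.coords (E.taylor m v) = v := by
  have hcur := E.isHCurve hm v
  rw [HCoordSystem.taylor, dif_pos hm]
  have h1 := f.isHChart.tendsto_coords hcur
  have h2 : Tendsto (fun t : ℝ => f.chart (E.toFun m (t • v.1, t ^ 2 • v.2))) (𝓝[≠] 0) (𝓝 0) := by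
    have h3 := (f.isHChart.contDiffAt_comp hcur).continuousAt
    have h4 := f.isHChart.apply_curve_zero hcur
    rw [← h4]
    exact h3.tendsto.mono_left nhdsWithin_le_nhds
  have h5 := tendsto_smul_dilation hs h0 h2 h1
  -- The radially corrected curve is exactly the dilation curve of `v`, so its rescaling is
  -- constantly `v` for `t ≠ 0`.
  refine tendsto_nhds_unique h5 (tendsto_const_nhds.congr' ?_)
  filter_upwards [self_mem_nhdsWithin] with t ht
  have ht : t ≠ 0 := ht
  rw [hE]
  refine Prod.ext ?_ ?_
  · simp [smul_smul, ht]
  · simp [smul_smul, ht]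

end AdaptedFrame

/-- Near `t = 0` the pair equals `ψ(b(t), F_{b(t)}(v(t)), t)`, where `v(t)` is the inverse dilation
of `E_{b(t)}⁻¹(a(t))`. The parameters converge to `(m, u', 0)`, which `ψ` sends to the claimed
limit. -/
theorem tendsto_pair {a b : ℝ → M} (ha : IsHCurve H m a) (hb : IsHCurve H m b) :
    let _ := f.osculatingGroup
    Tendsto (fun t : Ioc (0 : ℝ) 1 => TangentGroupoid.pair (H := H) (a t) (b t) t)
      (comap (Subtype.val : Ioc (0 : ℝ) 1 → ℝ) (𝓝 0))
      (𝓝 (TangentGroupoid.zero m (arrow ha * (arrow hb)⁻¹))) := by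
  intro _
  obtain ⟨E, s, N, hdom, hN, hs, h0, hE, hEm⟩ := f.exists_coordSystem
  have hmE : m ∈ E.dom := by rw [hdom]; exact f.base_mem_dom
  set u := arrow ha * (arrow hb)⁻¹ with hu
  set u' := f.isHChart.coords u with hu'
  have htay : E.taylor m u' = u :=
    f.isHChart.coords_injective (f.coords_taylor_base hmE hs h0 hEm u')
  -- the curves near `0`
  have hac : Tendsto a (𝓝 0) (𝓝 m) := by
    simpa [ha.base] using ha.contMDiffAt.continuousAt.tendsto
  have hbc : Tendsto b (𝓝 0) (𝓝 m) := by
    simpa [hb.base] using hb.contMDiffAt.continuousAt.tendsto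
  have hchart : Tendsto f.chart (𝓝 m) (𝓝 0) := by
    simpa [f.map_base] using f.isHChart.contMDiffAt.continuousAt.tendsto
  set w : ℝ → Coord p q := fun t => f.chart (a t) - f.chart (b t) with hw
  have hwc : Tendsto w (𝓝 0) (𝓝 0) := by
    simpa using (hchart.comp hac).sub (hchart.comp hbc)
  set k : ℝ → Coord p q := fun t => (f.frame (f.chart (b t))).symm (w t) with hk
  have hklim : Tendsto (fun t : ℝ => (t⁻¹ • (k t).1, (t⁻¹) ^ 2 • (k t).2)) (𝓝[≠] 0) (𝓝 u') :=
    f.tendsto_frame_symm_sub ha hb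
  set v : ℝ → Coord p q := fun t => (t⁻¹ • (s (w t) • k t).1, (t⁻¹) ^ 2 • (s (w t) • k t).2)
    with hv
  have hvlim : Tendsto v (𝓝[≠] 0) (𝓝 u') :=
    tendsto_smul_dilation hs h0 (hwc.mono_left nhdsWithin_le_nhds) hklim
  have hreach : ∀ᶠ t in 𝓝 (0 : ℝ), b t ∈ E.dom ∧ E.toFun (b t) (s (w t) • k t) = a t := by
    filter_upwards [hbc (f.isOpen_dom.mem_nhds f.base_mem_dom),
      hac (f.chart.open_source.mem_nhds f.mem_source), hwc hN] with t h1 h2 h3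
    refine ⟨by rw [hdom]; exact h1, ?_⟩
    have := hE (b t) h1 (a t) h2 h3
    rwa [map_smul] at this
  -- the path in the parametrization
  have hval : Tendsto (Subtype.val : Ioc (0 : ℝ) 1 → ℝ) (comap Subtype.val (𝓝 0)) (𝓝 0) :=
    tendsto_comap
  have hval' : Tendsto (Subtype.val : Ioc (0 : ℝ) 1 → ℝ) (comap Subtype.val (𝓝 0)) (𝓝[≠] 0) :=
    tendsto_nhdsWithin_iff.2 ⟨hval, Eventually.of_forall fun t => t.2.1.ne'⟩
  -- The truncation at `1/2` only serves to land in `[0, 1)`; it is the identity for small `t`.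
  let τ : Ioc (0 : ℝ) 1 → Ico (0 : ℝ) 1 := fun t =>
    ⟨min t (1 / 2), le_min t.2.1.le (by norm_num), (min_le_right _ _).trans_lt (by norm_num)⟩
  have hτ : Tendsto τ (comap Subtype.val (𝓝 0)) (𝓝 ⟨0, le_rfl, one_pos⟩) := by
    rw [tendsto_subtype_rng]
    have := hval.min (tendsto_const_nhds (x := (1 / 2 : ℝ)))
    rwa [min_eq_left (by norm_num : (0 : ℝ) ≤ 1 / 2)] at this
  rw [tendsto_nhds]
  intro W hW hmem
  -- A neighbourhood in the groupoid has open preimage under every parametrization; only the one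
  -- built from `E` is needed.
  have hopen := hW.2 E.adaptedExp E
  have hlim : Tendsto (fun t : Ioc (0 : ℝ) 1 => (b t, v t, τ t)) (comap Subtype.val (𝓝 0))
      (𝓝 (m, u', ⟨0, le_rfl, one_pos⟩)) :=
    (hbc.comp hval).prodMk_nhds ((hvlim.comp hval').prodMk_nhds hτ)
  have hbase : (m, u', (⟨0, le_rfl, one_pos⟩ : Ico (0 : ℝ) 1)) ∈
      {z : M × Coord p q × Ico (0 : ℝ) 1 | z.1 ∈ E.adaptedExp.dom ∩ E.dom ∧
        E.adaptedExp.psi z.1 (E.taylor z.1 z.2.1) z.2.2 ∈ W} := by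
    refine ⟨⟨hmE, hmE⟩, ?_⟩
    simp only [HAdaptedExp.psi, lt_irrefl, dif_neg, not_false_eq_true, htay]
    exact hmem
  filter_upwards [hlim (hopen.mem_nhds hbase), hval.eventually hreach,
    hval.eventually (gt_mem_nhds (by norm_num : (0 : ℝ) < 1 / 2))] with t h1 h2 h3
  have hτt : ((τ t : Ico (0 : ℝ) 1) : ℝ) = t := min_eq_left h3.le
  have h4 := h1.2
  have hpos : (0 : ℝ) < (τ t : Ico (0 : ℝ) 1) := by rw [hτt]; exact t.2.1
  have hne : (t : ℝ) ≠ 0 := t.2.1.ne'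
  simp only [HAdaptedExp.psi] at h4
  rw [dif_pos hpos, E.dilate_taylor h2.1, E.adaptedExp_taylor h2.1] at h4
  have h5 : (((τ t : Ico (0 : ℝ) 1) : ℝ) • (v t).1, ((τ t : Ico (0 : ℝ) 1) : ℝ) ^ 2 • (v t).2) =
      s (w t) • k t := by
    rw [hτt]
    refine Prod.ext ?_ ?_
    · simp only [hv]
      rw [smul_smul, mul_inv_cancel₀ hne, one_smul]
    · simp only [hv]
      rw [smul_smul, ← mul_pow, mul_inv_cancel₀ hne, one_pow, one_smul]
  rw [h5, h2.2] at h4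
  have h6 : (⟨τ t, hpos, (τ t).2.2.le⟩ : Ioc (0 : ℝ) 1) = t := Subtype.ext hτt
  rwa [h6] at h4

end limits

end Parabolic

end

/-- The equivalence with `IsComposition` pins down the multiplication uniquely and contains both
well-definedness of the composition and its existence for all pairs. The `comap` filter on `(0, 1]`
is `t → 0⁺`. -/
theorem mainTheorem6 {p q : ℕ} {M : Type*} [TopologicalSpace M]
    [ChartedSpace (EuclideanSpace ℝ (Fin (p + q))) M] [IsManifold (𝓡 (p + q)) ∞ M]
    (H : Parabolic.TangentDistribution p q M) (m : M) (a b : ℝ → M)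
    (ha : Parabolic.IsHCurve H m a) (hb : Parabolic.IsHCurve H m b) :
    ∃ _osculatingGroup : Group (Parabolic.Arrow H m),
      (∀ u v w : Parabolic.Arrow H m, Parabolic.IsComposition u v w ↔ u * v = w) ∧
      Tendsto
        (fun t : Ioc (0 : ℝ) 1 => Parabolic.TangentGroupoid.pair (H := H) (a t) (b t) t)
        (comap (Subtype.val : Ioc (0 : ℝ) 1 → ℝ) (𝓝 0))
        (𝓝 (Parabolic.TangentGroupoid.zero m
          (Parabolic.arrow ha * (Parabolic.arrow hb)⁻¹))) := by
  obtain ⟨f⟩ := Parabolic.exists_adaptedFrame H m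
  exact ⟨f.osculatingGroup, f.isComposition_iff, Parabolic.tendsto_pair f ha hb⟩
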